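/- Let $b>0$, $T>0$, $n\in\mathbb N$, $A\in\mathbb R^{n\times n}$, let $f\in C^2(\mathbb R^n,\mathbb R^n)$ be such that for some $\lambda>0$ one has $\langle Df(p)y+\lambda y,\,y\rangle\ge 0$ for all $p,y\in\mathbb R^n$, and let $\varphi\in H^2(-b,0;\mathbb R^n)$ and $g\in H^1(0,T;\mathbb R^n)$ (continuous representatives are used throughout; $\dot\varphi$ is continuous on $[-b,0]$). For $\tau\in[0,b]$ consider the delay equation $$\dot x(t)+f(x(t))=A\,x(t-\tau)+g(t)\ \text{ in }(0,T),\qquad x=\varphi\ \text{ on }[-b,0],$$ a solution being a function $x\in C([-b,T],\mathbb R^n)$ with $x|_{[0,T]}\in H^1(0,T;\mathbb R^n)$ and $x=\varphi$ on $[-b,0]$ that satisfies the differential equation almost everywhere in $(0,T)$. Then: 1. For each $\tau\in[0,b]$ there is exactly one solution, denoted $x[\tau]$. It belongs to $H^1(-b,T;\mathbb R^n)$, its restriction to $[0,T]$ belongs to $H^2(0,T;\mathbb R^n)$, and the limit $\dot x[\tau](0^+)=\lim_{t\downarrow0}\dot x[\tau](t)$ exists. We write $\ddot x[\tau]$ for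 the function that equals $\ddot\varphi$ on $(-b,0)$ and the second weak derivative of $x[\tau]|_{[0,T]}$ on $(0,T)$. 2. The map $\tau\mapsto x[\tau]$ is twice continuously differentiable from $[0,b]$ to $L^2(-b,T;\mathbb R^n)$ (one-sided derivatives at $0$ and $b$). Its derivatives $x'[\tau]$ and $x''[\tau]$ with respect to $\tau$ lie in the subspace of functions that vanish almost everywhere in $(-b,0)$, and $x'[\tau]\in H^1(-b,T;\mathbb R^n)$ with $x'[\tau]=0$ on $[-b,0]$. 3. For each $\tau\in[0,b]$, $x''[\tau]$ (for a suitable representative) satisfies the linear delay differential equation with impulse $$\begin{aligned}&\partial_t x''[\tau](t)+Df(x[\tau](t))\,x''[\tau](t)+D^2f(x[\tau](t))\big(x'[\tau](t),x'[\tau](t)\big)\\&\quad=A\,x''[\tau](t-\tau)-2A\,(\partial_t x'[\tau])(t-\tau)+A\,\ddot x[\tau](t-\tau)+\mu_\tau\quad\text{in }(0,T],\\&x''[\tau](t)=0\quad\text{in }[-b,0],\end{aligned}$$ where $\mu_\tau=A\big(\dot x[\tau](0^+)-\dot\varphi(0)\big)\,\delta_\tau$ and $\delta_\tau$ is the Dirac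 measure located at $\tau$. This equation holds in the sense of distributions on $(-b,T)$, where $x''[\tau]$ is zero on $(-b,0]$ and all terms of the equation other than $\partial_t x''[\tau]$ and $\mu_\tau$ are extended by zero to $(-b,0]$; it also holds in integrated form: for each $t\in(0,T]$, $x''[\tau](t)$ plus the integral over $(0,t]$ of the remaining terms on the left equals the integral over $(0,t]$ of the first three terms on the right plus $\mu_\tau((-b,t])$. 4. Consequently, if $\tau<T$, the one-sided limits of $x''[\tau]$ at $t=\tau$ exist and $$x''[\tau](\tau+0)-x''[\tau](\tau-0)=A\big(\dot x[\tau](0^+)-\dot\varphi(0)\big).$$ This jump $A\big(\dot x[\tau](0^+)-\dot\varphi(0)\big)$ vanishes if the compatibility condition $\dot\varphi(0)=-f(\varphi(0))+A\varphi(-\tau)+g(0)$ holds. -/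

import Mathlib

open MeasureTheory Filter Topology Set
open scoped ContDiff

/-- `ℝⁿ` with its Euclidean inner product. -/
abbrev Rn (n : ℕ) : Type := EuclideanSpace ℝ (Fin n)

/-- The continuous function `u` on `[a, c]` belongs to `H¹(a, c; ℝⁿ)` and its weak derivative is
`v ∈ L²(a, c; ℝⁿ)`: `u` is the (absolutely continuous) primitive of `v`. -/
def HasH1Deriv {n : ℕ} (a c : ℝ) (u v : ℝ → Rn n) : Prop :=
  MemLp v 2 (volume.restrict (Ioo a c)) ∧ ∀ t ∈ Icc a c, u t = u a + ∫ s in a..t, v s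

/-- `x` solves the delay equation `∂ₜ x(t) + f (x(t)) = A x(t - τ) + g(t)` in `(0, T)`,
`x = φ` on `[-b, 0]`: `x` is continuous on `[-b, T]`, its restriction to `[0, T]` is in
`H¹(0, T; ℝⁿ)`, and the differential equation holds almost everywhere in `(0, T)`. -/
def IsDelaySolution {n : ℕ} (f : Rn n → Rn n) (A : Rn n →L[ℝ] Rn n) (g φ : ℝ → Rn n)
    (b T τ : ℝ) (x : ℝ → Rn n) : Prop :=
  ContinuousOn x (Icc (-b) T) ∧ EqOn x φ (Icc (-b) 0) ∧
    ∃ v : ℝ → Rn n, HasH1Deriv 0 T x v ∧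
      ∀ᵐ t ∂(volume.restrict (Ioo 0 T)), v t + f (x t) = A (x (t - τ)) + g t

/-- The space `L²(-b, T; ℝⁿ)`. -/
abbrev L2Space (n : ℕ) (b T : ℝ) : Type :=
  Lp (Rn n) 2 ((volume : Measure ℝ).restrict (Ioo (-b) T))

/-- The subspace of those `w ∈ L²(-b, T; ℝⁿ)` with `w = 0` almost everywhere in `(-b, 0)`. -/
def L2Zero (n : ℕ) (b T : ℝ) : Submodule ℝ (L2Space n b T) where
  carrier := {w | ∀ᵐ t ∂((volume : Measure ℝ).restrict (Ioo (-b) T)), t < 0 → w t = 0}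
  zero_mem' := by
    filter_upwards [Lp.coeFn_zero (Rn n) 2 ((volume : Measure ℝ).restrict (Ioo (-b) T))]
      with t ht _
    rw [ht]; rfl
  add_mem' := by
    intro u v hu hv
    rw [mem_ofPred_eq] at hu hv ⊢
    filter_upwards [Lp.coeFn_add u v, hu, hv] with t ht h1 h2 h
    rw [ht, Pi.add_apply, h1 h, h2 h, add_zero]
  smul_mem' := by
    intro c u hu
    rw [mem_ofPred_eq] at hu ⊢
    filter_upwards [Lp.coeFn_smul c u, hu] with t ht h1 h
    rw [ht, Pi.smul_apply, h1 h, smul_zero]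

/-- `τ ↦ x[τ]` is twice continuously differentiable on `[0, b]` (one-sided derivatives at the
end points) as a map into `L²(-b, T; ℝⁿ)`; its first and second derivatives at `τ` are the classes
of `w[τ]` and `v[τ]`, and they lie in the subspace `L2Zero`. -/
def IsTwiceContDiffL2 {n : ℕ} (b T : ℝ) (x w v : ℝ → ℝ → Rn n) : Prop :=
  ∃ X W V : ℝ → L2Space n b T,
    (∀ τ ∈ Icc 0 b,
      X τ =ᵐ[volume.restrict (Ioo (-b) T)] x τ ∧
      W τ =ᵐ[volume.restrict (Ioo (-b) T)] w τ ∧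
      V τ =ᵐ[volume.restrict (Ioo (-b) T)] v τ ∧
      W τ ∈ L2Zero n b T ∧ V τ ∈ L2Zero n b T ∧
      HasDerivWithinAt X (W τ) (Icc 0 b) τ ∧ HasDerivWithinAt W (V τ) (Icc 0 b) τ) ∧
    ContinuousOn V (Icc 0 b)

/-- `v` solves `∂ₜ v + m = h + J δ_τ` in `(0, T]`, `v = 0` on `[-b, 0]`, where `δ_τ` is the Dirac
measure at `τ`. The equation is required in both of its usual meanings: integrated over `(-b, t]`
for each `t ∈ (0, T]` (where `v` is the representative that includes the impulse at its time), and
tested with smooth functions with compact support in `(-b, T)`. -/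
def SolvesImpulsiveEquation {n : ℕ} (b T τ : ℝ) (J : Rn n) (m h v : ℝ → Rn n) : Prop :=
  (∀ t ∈ Icc (-b) 0, v t = 0) ∧
  IntegrableOn v (Ioo (-b) T) ∧ IntegrableOn m (Ioo 0 T) ∧ IntegrableOn h (Ioo 0 T) ∧
  (∀ t ∈ Ioc 0 T, v t + ∫ s in 0..t, m s =
    (∫ s in 0..t, h s) + (Measure.dirac τ).real (Iic t) • J) ∧
  (∀ ψ : ℝ → ℝ, ContDiff ℝ ∞ ψ → HasCompactSupport ψ → tsupport ψ ⊆ Ioo (-b) T →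
    -(∫ t in Ioo (-b) T, deriv ψ t • v t) + ∫ t in Ioo 0 T, ψ t • m t =
      (∫ t in Ioo 0 T, ψ t • h t) + (∫ t, ψ t ∂(Measure.dirac τ)) • J)

/-!
Integrating in time removes every derivative of a shifted function from the problem. With
`∂ₜ x[τ](s - τ)` integrated, the equations for the solution `x`, for `w = x'` and for `v = x''` are

* `x(t) = φ(0) + ∫₀ᵗ (A x(s - τ) - f(x) + g)`,
* `w(t) = -A (x(t - τ) - φ(-τ)) + ∫₀ᵗ (A w(s - τ) - Df(x) w)`,
* `v(t) = A (ẋ(t - τ) - φ̇(-τ)) - 2 A w(t - τ) + ∫₀ᵗ (A v(s - τ) - Df(x) v - D²f(x)(w, w))`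

for `t ∈ (0, T]`, with histories `φ`, `0`, `0`. The structure `SensitivityFamily` collects them. All
three are Volterra equations, solved by a fixed point (`exists_delay_solution`), and perturbations
of them are controlled by Grönwall's inequality with constants that do not depend on the delay
(`delay_estimate`). The time derivative `ẋ` is continuous on both sides of zero and may jump there,
so the inhomogeneity of the last equation jumps at `t = τ`; writing it as the integral of
`ẍ(s - τ)` plus this jump turns the last equation into the equation with impulse
(`v_eq_primitive`, `solvesImpulsiveEquation_of_primitive`).

Differentiability into `L²` follows from pointwise differentiability at almost every time together
with Lipschitz bounds in the delay that are uniform in time (`hasDerivWithinAt_Lp_two`). The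
pointwise statement is one lemma, `delay_hasDerivWithinAt`, applied to `x` and then to `w`: the
difference quotient minus the expected derivative solves a linear delay equation whose data are
bounded and tend to zero at almost every time, hence tends to zero by `delay_tendsto_zero`. The
exceptional time for `w` is `t = τ`, where the inhomogeneity `x[σ](t - σ)` is differentiated across
the corner of the solution at zero. The continuity of `v` in `L²` is another application of
`delay_tendsto_zero` (`tendsto_v`).

The one-sided bound on `Df` enters only through an energy estimate
(`exists_delay_a_priori_bound`), which bounds all solutions for all delays by one constant `R`.
Multiplying `f - f 0` by a cutoff preserves this estimate (`exists_truncation`), so that `f` may be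
replaced by a nonlinearity which is globally bounded with its derivatives and agrees with `f` on the
ball of radius `R`, hence along all solutions.
-/

/-! ### Locally bounded measurable functions of time -/

/-- A strongly measurable function on the line that is bounded on bounded sets. Such functions
are integrable on every bounded interval, and they are stable under all operations used below. -/
structure LocBddMeas {F : Type*} [NormedAddCommGroup F] (u : ℝ → F) : Prop where
  meas : StronglyMeasurable u
  bdd : ∀ R : ℝ, ∃ C, ∀ t, |t| ≤ R → ‖u t‖ ≤ C

namespace LocBddMeas

variable {F G : Type*} [NormedAddCommGroup F] [NormedAddCommGroup G] {u v : ℝ → F}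

lemma of_continuous (hu : Continuous u) :
    LocBddMeas u where
  meas := hu.stronglyMeasurable
  bdd R := by
    obtain ⟨C, hC⟩ :=
      (isCompact_Icc (a := -R) (b := R)).exists_bound_of_continuousOn hu.continuousOn
    exact ⟨C, fun t ht => hC t (abs_le.mp ht)⟩

lemma add (hu : LocBddMeas u) (hv : LocBddMeas v) : LocBddMeas fun t => u t + v t where
  meas := hu.meas.add hv.meas
  bdd R := by
    obtain ⟨C, hC⟩ := hu.bdd R
    obtain ⟨D, hD⟩ := hv.bdd R
    exact ⟨C + D, fun t ht => (norm_add_le _ _).trans (add_le_add (hC t ht) (hD t ht))⟩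

lemma sub (hu : LocBddMeas u) (hv : LocBddMeas v) : LocBddMeas fun t => u t - v t where
  meas := hu.meas.sub hv.meas
  bdd R := by
    obtain ⟨C, hC⟩ := hu.bdd R
    obtain ⟨D, hD⟩ := hv.bdd R
    exact ⟨C + D, fun t ht => (norm_sub_le _ _).trans (add_le_add (hC t ht) (hD t ht))⟩

lemma norm (hu : LocBddMeas u) : LocBddMeas fun t => ‖u t‖ where
  meas := hu.meas.norm
  bdd R := by
    obtain ⟨C, hC⟩ := hu.bdd R
    exact ⟨C, fun t ht => by simpa using hC t ht⟩

lemma comp_sub_right (hu : LocBddMeas u) (τ : ℝ) : LocBddMeas fun t => u (t - τ) where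
  meas := hu.meas.comp_measurable (measurable_id.sub_const τ)
  bdd R := by
    obtain ⟨C, hC⟩ := hu.bdd (R + |τ|)
    exact ⟨C, fun t ht => hC _ ((abs_sub _ _).trans (by gcongr))⟩

lemma const (c : F) : LocBddMeas fun _ : ℝ => c := of_continuous continuous_const

/-- Gluing two functions at a point of the line. -/
lemma ite {p : ℝ → Prop} [DecidablePred p] (hp : MeasurableSet {t | p t}) (hu : LocBddMeas u)
    (hv : LocBddMeas v) : LocBddMeas fun t => if p t then u t else v t where
  meas := StronglyMeasurable.ite hp hu.meas hv.meas
  bdd R := by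
    obtain ⟨C, hC⟩ := hu.bdd R
    obtain ⟨D, hD⟩ := hv.bdd R
    refine ⟨max C D, fun t ht => ?_⟩
    split_ifs
    · exact (hC t ht).trans (le_max_left _ _)
    · exact (hD t ht).trans (le_max_right _ _)

lemma exists_bound_Icc (hu : LocBddMeas u)
    (a c : ℝ) : ∃ C, ∀ t ∈ Icc a c, ‖u t‖ ≤ C := by
  obtain ⟨C, hC⟩ := hu.bdd (max |a| |c|)
  exact ⟨C, fun t ht => hC t (abs_le_max_abs_abs ht.1 ht.2)⟩

lemma integrableOn_Icc (hu : LocBddMeas u)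
    (a c : ℝ) : IntegrableOn u (Icc a c) := by
  obtain ⟨C, hC⟩ := hu.exists_bound_Icc a c
  exact Measure.integrableOn_of_bounded (M := C) (by simp) hu.meas.aestronglyMeasurable
    (ae_restrict_of_forall_mem measurableSet_Icc hC)

lemma intervalIntegrable (hu : LocBddMeas u)
    (a c : ℝ) : IntervalIntegrable u volume a c := by
  rw [intervalIntegrable_iff]
  exact (hu.integrableOn_Icc (min a c) (max a c)).mono_set Ioc_subset_Icc_self

lemma memLp_Ioo (hu : LocBddMeas u)
    (a c : ℝ) : MemLp u 2 (volume.restrict (Ioo a c)) := by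
  obtain ⟨C, hC⟩ := hu.exists_bound_Icc a c
  exact MemLp.of_bound hu.meas.aestronglyMeasurable C
    (ae_restrict_of_forall_mem measurableSet_Ioo fun t ht => hC t (Ioo_subset_Icc_self ht))

variable [NormedSpace ℝ F] [NormedSpace ℝ G]

lemma clm_apply {L : ℝ → F →L[ℝ] G} (hL : LocBddMeas L) (hu : LocBddMeas u) :
    LocBddMeas fun t => L t (u t) where
  meas := by
    have h : Continuous fun q : (F →L[ℝ] G) × F => q.1 q.2 := isBoundedBilinearMap_apply.continuous
    exact h.comp_stronglyMeasurable (hL.meas.prodMk hu.meas)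
  bdd R := by
    obtain ⟨C, hC⟩ := hL.bdd R
    obtain ⟨D, hD⟩ := hu.bdd R
    exact ⟨C * D, fun t ht => ((L t).le_opNorm _).trans
      (mul_le_mul (hC t ht) (hD t ht) (norm_nonneg _) ((norm_nonneg _).trans (hC t ht)))⟩

lemma clm (L : F →L[ℝ] G) (hu : LocBddMeas u) : LocBddMeas fun t => L (u t) :=
  (const L).clm_apply hu

lemma const_smul (c : ℝ) (hu : LocBddMeas u) : LocBddMeas fun t => c • u t :=
  hu.clm (c • ContinuousLinearMap.id ℝ F)

lemma const_mul {u : ℝ → ℝ} (c : ℝ) (hu : LocBddMeas u) : LocBddMeas fun t => c * u t :=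
  hu.const_smul c

lemma continuous_integral (hu : LocBddMeas u) (a : ℝ) :
    Continuous fun t => ∫ s in a..t, u s :=
  intervalIntegral.continuous_primitive (fun a c => hu.intervalIntegrable a c) a

end LocBddMeas

/-! ### Integral inequalities -/

/-- The integral of a nonnegative function shifted to the right by the delay is controlled by the
integral of the function and of its history. -/
lemma integral_comp_sub_le {u : ℝ → ℝ} (hu : LocBddMeas u) (h0 : ∀ t, 0 ≤ u t) {τ : ℝ}
    (hτ : 0 ≤ τ) (t : ℝ) :
    ∫ s in 0..t, u (s - τ) ≤ (∫ s in -τ..0, u s) + ∫ s in 0..t, u s := by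
  rw [intervalIntegral.integral_comp_sub_right (fun s => u s) τ, zero_sub,
    intervalIntegral.integral_add_adjacent_intervals (hu.intervalIntegrable _ _)
      (hu.intervalIntegrable _ _),
    ← intervalIntegral.integral_add_adjacent_intervals (hu.intervalIntegrable (-τ) (t - τ))
      (hu.intervalIntegrable _ t)]
  have := intervalIntegral.integral_nonneg (μ := volume) (show t - τ ≤ t by linarith)
    (fun s _ => h0 s)
  linarith

/-- Grönwall's inequality in integral form, for a function that need not be continuous and a
forcing term that may depend on time. -/
lemma gronwall_integral {u α : ℝ → ℝ} {K T : ℝ} (hu : LocBddMeas u) (hα : LocBddMeas α)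
    (hα0 : ∀ t ∈ Icc 0 T, 0 ≤ α t) (hK : 0 ≤ K)
    (h : ∀ t ∈ Icc 0 T, u t ≤ α t + K * ∫ s in 0..t, u s) :
    ∀ t ∈ Icc 0 T, u t ≤ α t + K * Real.exp (K * T) * ∫ s in 0..T, α s := by
  intro t ht
  set a := ∫ s in 0..T, α s with ha
  set U : ℝ → ℝ := fun t => ∫ s in 0..t, u s with hU
  have hUc : Continuous U := hu.continuous_integral 0
  -- Integrating the hypothesis once replaces `u` by its continuous primitive `U`.
  have hUle : ∀ r ∈ Icc 0 T, U r ≤ a + K * ∫ s in 0..r, U s := by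
    intro r hr
    have h1 : U r ≤ ∫ s in 0..r, (α s + K * U s) :=
      intervalIntegral.integral_mono_on hr.1 (hu.intervalIntegrable _ _)
        ((hα.intervalIntegrable _ _).add ((hUc.const_mul K).intervalIntegrable _ _))
        fun s hs => h s ⟨hs.1, hs.2.trans hr.2⟩
    rw [intervalIntegral.integral_add (hα.intervalIntegrable _ _)
      ((hUc.const_mul K).intervalIntegrable _ _), intervalIntegral.integral_const_mul] at h1
    have h2 : ∫ s in 0..r, α s ≤ a := by
      rw [ha, ← intervalIntegral.integral_add_adjacent_intervals (hα.intervalIntegrable 0 r)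
        (hα.intervalIntegrable r T)]
      have := intervalIntegral.integral_nonneg (μ := volume) hr.2
        (fun s hs => hα0 s ⟨hr.1.trans hs.1, hs.2⟩)
      linarith
    linarith
  have hP : ∀ r, HasDerivAt (fun r => a + K * ∫ s in 0..r, U s) (K * U r) r := fun r =>
    ((intervalIntegral.integral_hasDerivAt_right (hUc.intervalIntegrable _ _)
      hUc.stronglyMeasurable.stronglyMeasurableAtFilter hUc.continuousAt).const_mul K).const_add a
  have hG := le_gronwallBound_of_liminf_deriv_right_le (f := fun r => a + K * ∫ s in 0..r, U s)
    (f' := fun r => K * U r) (δ := a) (K := K) (ε := 0) (a := 0) (b := T)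
    (fun r _ => (hP r).continuousAt.continuousWithinAt)
    (fun r _ y hy => (hP r).hasDerivWithinAt.liminf_right_slope_le hy)
    (by simp) (fun r hr => by
      have := hUle r ⟨hr.1, hr.2.le⟩
      simpa using mul_le_mul_of_nonneg_left this hK) t ht
  rw [gronwallBound_ε0, sub_zero] at hG
  have ha0 : 0 ≤ a := intervalIntegral.integral_nonneg (ht.1.trans ht.2) hα0
  have h3 : U t ≤ a * Real.exp (K * T) :=
    (hUle t ht).trans (hG.trans (by gcongr; exact ht.2))
  have := mul_le_mul_of_nonneg_left h3 hK
  have h4 := h t ht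
  calc u t ≤ α t + K * U t := h4
    _ ≤ α t + K * (a * Real.exp (K * T)) := by linarith
    _ = _ := by ring

section Delay

variable {E : Type*} [NormedAddCommGroup E] [NormedSpace ℝ E]

/-- The a priori estimate for linear perturbations of the delay equation: a function with zero
history that solves `z t = a t + ∫₀ᵗ (A z(s - σ) - k s) ds`, where `k` is controlled by `z` up to
an error `κ`, is controlled by `a` and `κ`, with constants that do not depend on `σ`. -/
lemma delay_estimate {A : E →L[ℝ] E} {z a k : ℝ → E} {κ : ℝ → ℝ} {K T σ : ℝ}
    (hz : LocBddMeas z) (hz0 : ∀ t ≤ 0, z t = 0) (hσ : 0 ≤ σ) (ha : LocBddMeas a)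
    (hκ : LocBddMeas κ) (hκ0 : ∀ s, 0 ≤ κ s) (hK : 0 ≤ K)
    (hkz : ∀ s ∈ Icc 0 T, ‖k s‖ ≤ K * ‖z s‖ + κ s)
    (heq : ∀ t ∈ Ioc 0 T, z t = a t + ∫ s in 0..t, (A (z (s - σ)) - k s)) :
    ∀ t ∈ Icc 0 T, ‖z t‖ ≤ (‖a t‖ + ∫ s in 0..T, κ s) + (K + ‖A‖) * Real.exp ((K + ‖A‖) * T) *
      ∫ s in 0..T, (‖a s‖ + ∫ s in 0..T, κ s) := by
  refine gronwall_integral hz.norm (ha.norm.add (LocBddMeas.const _)) (fun t ht => ?_)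
    (by positivity) (fun t ht => ?_)
  · have := intervalIntegral.integral_nonneg (μ := volume) (ht.1.trans ht.2) (fun s _ => hκ0 s)
    have := norm_nonneg (a t)
    linarith
  rcases eq_or_lt_of_le ht.1 with rfl | ht0
  · have := intervalIntegral.integral_nonneg (μ := volume) ht.2 (fun s _ => hκ0 s)
    rw [hz0 0 le_rfl, norm_zero, intervalIntegral.integral_same, mul_zero, add_zero]
    positivity
  have hzs := (hz.comp_sub_right σ).norm
  have h1 : ‖∫ s in 0..t, (A (z (s - σ)) - k s)‖ ≤
      ∫ s in 0..t, (‖A‖ * ‖z (s - σ)‖ + (K * ‖z s‖ + κ s)) := by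
    refine intervalIntegral.norm_integral_le_of_norm_le ht.1 ?_
      ((((hzs.const_mul ‖A‖)).add ((hz.norm.const_mul K).add hκ)).intervalIntegrable 0 t)
    refine Filter.Eventually.of_forall fun s hs => (norm_sub_le _ _).trans ?_
    exact add_le_add (A.le_opNorm _) (hkz s ⟨hs.1.le, hs.2.trans ht.2⟩)
  have h2 : ∫ s in 0..t, (‖A‖ * ‖z (s - σ)‖ + (K * ‖z s‖ + κ s)) =
      ‖A‖ * (∫ s in 0..t, ‖z (s - σ)‖) + (K * (∫ s in 0..t, ‖z s‖) + ∫ s in 0..t, κ s) := by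
    rw [intervalIntegral.integral_add ((hzs.const_mul ‖A‖).intervalIntegrable _ _)
      (((hz.norm.const_mul K).add hκ).intervalIntegrable _ _),
      intervalIntegral.integral_add ((hz.norm.const_mul K).intervalIntegrable _ _)
      (hκ.intervalIntegrable _ _), intervalIntegral.integral_const_mul,
      intervalIntegral.integral_const_mul]
  have h3 : ∫ s in 0..t, ‖z (s - σ)‖ ≤ ∫ s in 0..t, ‖z s‖ := by
    have h4 := integral_comp_sub_le hz.norm (fun t => norm_nonneg _) hσ t
    have h5 : ∫ s in -σ..0, ‖z s‖ = 0 := by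
      refine intervalIntegral.integral_zero_ae (Filter.Eventually.of_forall fun s hs => ?_)
      rw [uIoc_of_le (by linarith)] at hs
      rw [hz0 s hs.2, norm_zero]
    linarith
  have h6 : ∫ s in 0..t, κ s ≤ ∫ s in 0..T, κ s := by
    rw [← intervalIntegral.integral_add_adjacent_intervals (hκ.intervalIntegrable 0 t)
        (hκ.intervalIntegrable t T)]
    have := intervalIntegral.integral_nonneg (μ := volume) ht.2 (fun s _ => hκ0 s)
    linarith
  have h7 := mul_le_mul_of_nonneg_left h3 (norm_nonneg A)
  calc ‖z t‖ ≤ ‖a t‖ + ‖∫ s in 0..t, (A (z (s - σ)) - k s)‖ := by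
        rw [heq t ⟨ht0, ht.2⟩]; exact norm_add_le _ _
    _ ≤ _ := by
        rw [h2] at h1
        linarith

/-- The a priori estimate with bounds that do not depend on time. -/
lemma delay_bound {A : E →L[ℝ] E} {z a k : ℝ → E} {K T σ c₁ c₂ : ℝ}
    (hz : LocBddMeas z) (hz0 : ∀ t ≤ 0, z t = 0) (hσ : 0 ≤ σ) (ha : LocBddMeas a)
    (hK : 0 ≤ K) (hT : 0 ≤ T) (hc₁ : 0 ≤ c₁) (hc₂ : 0 ≤ c₂) (hac : ∀ t ∈ Ioc 0 T, ‖a t‖ ≤ c₁)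
    (hkz : ∀ s ∈ Icc 0 T, ‖k s‖ ≤ K * ‖z s‖ + c₂)
    (heq : ∀ t ∈ Ioc 0 T, z t = a t + ∫ s in 0..t, (A (z (s - σ)) - k s)) :
    ∀ t ≤ T, ‖z t‖ ≤ (1 + (K + ‖A‖) * Real.exp ((K + ‖A‖) * T) * T) * (c₁ + T * c₂) := by
  intro t htT
  rcases le_or_gt t 0 with ht | ht
  · rw [hz0 t ht, norm_zero]
    positivity
  have h1 := delay_estimate hz hz0 hσ ha (LocBddMeas.const c₂) (fun _ => hc₂) hK hkz heq t
    ⟨ht.le, htT⟩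
  rw [intervalIntegral.integral_const, sub_zero, smul_eq_mul] at h1
  have h2 : ∫ s in 0..T, (‖a s‖ + T * c₂) ≤ ∫ s in 0..T, (c₁ + T * c₂) :=
    intervalIntegral.integral_mono_on_of_le_Ioo hT
      ((ha.norm.add (LocBddMeas.const _)).intervalIntegrable _ _)
      ((LocBddMeas.const _).intervalIntegrable _ _)
      fun s hs => by have := hac s ⟨hs.1, hs.2.le⟩; linarith
  rw [intervalIntegral.integral_const, sub_zero, smul_eq_mul] at h2
  have h3 := mul_le_mul_of_nonneg_left h2
    (show 0 ≤ (K + ‖A‖) * Real.exp ((K + ‖A‖) * T) by positivity)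
  have h4 := hac t ⟨ht, htT⟩
  calc ‖z t‖ ≤ _ := h1
    _ ≤ (c₁ + T * c₂) + (K + ‖A‖) * Real.exp ((K + ‖A‖) * T) * (T * (c₁ + T * c₂)) := by
      linarith
    _ = _ := by ring

/-- A delayed integral in terms of a primitive of the delayed function. -/
lemma integral_delay [CompleteSpace E] (A : E →L[ℝ] E) {y n : ℝ → E} (hy : LocBddMeas y)
    (hn : LocBddMeas n) (σ t : ℝ) :
    ∫ s in 0..t, (A (y (s - σ)) - n s) =
      A ((∫ s in 0..t - σ, y s) - ∫ s in 0..-σ, y s) - ∫ s in 0..t, n s := by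
  rw [intervalIntegral.integral_sub (((hy.comp_sub_right σ).clm A).intervalIntegrable _ _)
    (hn.intervalIntegrable _ _), A.intervalIntegral_comp_comm
    ((hy.comp_sub_right σ).intervalIntegrable _ _),
    intervalIntegral.integral_comp_sub_right (fun s => y s) σ, zero_sub,
    intervalIntegral.integral_interval_sub_left (hy.intervalIntegrable _ _)
      (hy.intervalIntegrable _ _)]

/-- The equation for the difference of two solutions with different data and delays: changing the
delay in a given function only costs a difference of primitives. -/
lemma delay_sub_eq [CompleteSpace E] (A : E →L[ℝ] E) {y₁ y₂ n₁ n₂ q₁ q₂ : ℝ → E} {σ τ t : ℝ}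
    (hy₁ : LocBddMeas y₁) (hy₂ : LocBddMeas y₂) (hn₁ : LocBddMeas n₁) (hn₂ : LocBddMeas n₂)
    (h₁ : y₁ t = q₁ t + ∫ s in 0..t, (A (y₁ (s - σ)) - n₁ s))
    (h₂ : y₂ t = q₂ t + ∫ s in 0..t, (A (y₂ (s - τ)) - n₂ s)) :
    y₁ t - y₂ t = (q₁ t - q₂ t + A (((∫ s in 0..t - σ, y₂ s) - ∫ s in 0..t - τ, y₂ s) -
        ((∫ s in 0..-σ, y₂ s) - ∫ s in 0..-τ, y₂ s))) +
      ∫ s in 0..t, (A (y₁ (s - σ) - y₂ (s - σ)) - (n₁ s - n₂ s)) := by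
  rw [h₁, h₂, integral_delay A hy₁ hn₁, integral_delay A hy₂ hn₂,
    integral_delay A (hy₁.sub hy₂) (hn₁.sub hn₂),
    intervalIntegral.integral_sub (hy₁.intervalIntegrable _ _) (hy₂.intervalIntegrable _ _),
    intervalIntegral.integral_sub (hy₁.intervalIntegrable _ _) (hy₂.intervalIntegrable _ _),
    intervalIntegral.integral_sub (hn₁.intervalIntegrable _ _) (hn₂.intervalIntegrable _ _)]
  simp only [map_sub]
  abel

lemma norm_primitive_sub_le {y : ℝ → E} (hy : LocBddMeas y) {a c C : ℝ}
    (hC : ∀ t ∈ Icc a c, ‖y t‖ ≤ C) {r s : ℝ} (hr : r ∈ Icc a c) (hs : s ∈ Icc a c) :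
    ‖(∫ t in 0..r, y t) - ∫ t in 0..s, y t‖ ≤ C * |r - s| := by
  rw [intervalIntegral.integral_interval_sub_left (hy.intervalIntegrable _ _)
      (hy.intervalIntegrable _ _)]
  refine intervalIntegral.norm_integral_le_of_norm_le_const fun t ht => hC t ?_
  exact (convex_Icc a c).ordConnected.uIcc_subset hs hr (uIoc_subset_uIcc ht)

end Delay

section Delay

variable {E : Type*} [NormedAddCommGroup E] [NormedSpace ℝ E]

/-- Passage to the limit in perturbed delay equations: if the data `a σ`, `κ σ` stay bounded and
tend to zero for almost every time, then the solutions `z σ` of the perturbed equations tend to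
zero at every time at which `a σ` does. -/
lemma delay_tendsto_zero {A : E →L[ℝ] E} {l : Filter ℝ} [l.IsCountablyGenerated]
    {z a k : ℝ → ℝ → E} {κ : ℝ → ℝ → ℝ} {K T C : ℝ} {Z : Set ℝ} (hZ : Z.Countable)
    (hK : 0 ≤ K)
    (hz : ∀ᶠ σ in l, 0 ≤ σ ∧ LocBddMeas (z σ) ∧ (∀ t ≤ 0, z σ t = 0) ∧ LocBddMeas (a σ) ∧
      LocBddMeas (κ σ) ∧ (∀ s, 0 ≤ κ σ s) ∧
      (∀ s ∈ Icc 0 T, ‖k σ s‖ ≤ K * ‖z σ s‖ + κ σ s) ∧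
      (∀ t ∈ Ioc 0 T, z σ t = a σ t + ∫ s in 0..t, (A (z σ (s - σ)) - k σ s)) ∧
      (∀ t ∈ Ioc 0 T, ‖a σ t‖ ≤ C) ∧ (∀ t ∈ Ioc 0 T, κ σ t ≤ C))
    (ha : ∀ t ∈ Ioc 0 T, t ∉ Z → Tendsto (fun σ => a σ t) l (𝓝 0))
    (hκ : ∀ t ∈ Ioc 0 T, t ∉ Z → Tendsto (fun σ => κ σ t) l (𝓝 0)) :
    ∀ t ∈ Ioc 0 T, t ∉ Z → Tendsto (fun σ => z σ t) l (𝓝 0) := by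
  intro t ht htZ
  have hT : 0 ≤ T := ht.1.le.trans ht.2
  have hI1 : Tendsto (fun σ => ∫ s in 0..T, κ σ s) l (𝓝 0) := by
    have := intervalIntegral.tendsto_integral_filter_of_dominated_convergence (μ := volume)
      (F := κ) (f := fun _ => (0 : ℝ)) (l := l) (a := 0) (b := T) (fun _ => C)
      (hz.mono fun σ h => h.2.2.2.2.1.meas.aestronglyMeasurable)
      (hz.mono fun σ h => Eventually.of_forall fun s hs => by
        rw [uIoc_of_le hT] at hs
        rw [Real.norm_of_nonneg (h.2.2.2.2.2.1 s)]
        exact h.2.2.2.2.2.2.2.2.2 s hs)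
      (by simp)
      (by
        filter_upwards [hZ.ae_notMem volume] with s hsZ hs
        rw [uIoc_of_le hT] at hs
        exact hκ s hs hsZ)
    simpa using this
  have hI2 : Tendsto (fun σ => ∫ s in 0..T, ‖a σ s‖) l (𝓝 0) := by
    have := intervalIntegral.tendsto_integral_filter_of_dominated_convergence (μ := volume)
      (F := fun σ s => ‖a σ s‖) (f := fun _ => (0 : ℝ)) (l := l) (a := 0) (b := T) (fun _ => C)
      (hz.mono fun σ h => h.2.2.2.1.norm.meas.aestronglyMeasurable)
      (hz.mono fun σ h => Eventually.of_forall fun s hs => by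
        rw [uIoc_of_le hT] at hs
        rw [norm_norm]
        exact h.2.2.2.2.2.2.2.2.1 s hs)
      (by simp)
      (by
        filter_upwards [hZ.ae_notMem volume] with s hsZ hs
        rw [uIoc_of_le hT] at hs
        simpa using (ha s hs hsZ).norm)
    simpa using this
  have hlim : Tendsto (fun σ => (‖a σ t‖ + ∫ s in 0..T, κ σ s) +
      (K + ‖A‖) * Real.exp ((K + ‖A‖) * T) *
        ((∫ s in 0..T, ‖a σ s‖) + T * ∫ s in 0..T, κ σ s)) l (𝓝 0) := by
    have := ((ha t ht htZ).norm.add hI1).add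
      ((hI2.add (hI1.const_mul T)).const_mul ((K + ‖A‖) * Real.exp ((K + ‖A‖) * T)))
    simpa using this
  refine squeeze_zero_norm' (hz.mono fun σ h => ?_) hlim
  have := delay_estimate h.2.1 h.2.2.1 h.1 h.2.2.2.1 h.2.2.2.2.1 h.2.2.2.2.2.1 hK
    h.2.2.2.2.2.2.1 h.2.2.2.2.2.2.2.1 t ⟨ht.1.le, ht.2⟩
  rwa [intervalIntegral.integral_add (h.2.2.2.1.norm.intervalIntegrable _ _)
    ((LocBddMeas.const _).intervalIntegrable _ _), intervalIntegral.integral_const, sub_zero,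
    smul_eq_mul] at this

/-- Existence for the delay equation in integrated form, with history and inhomogeneity `p` and a
nonlinearity `N s` that is Lipschitz continuous uniformly in time. -/
lemma exists_delay_solution [CompleteSpace E] (A : E →L[ℝ] E) {T τ K : ℝ} (hT : 0 ≤ T)
    (hτ : 0 ≤ τ) (hK : 0 ≤ K) {N : ℝ → E → E} (hN : ∀ s a c, ‖N s a - N s c‖ ≤ K * ‖a - c‖)
    (hNm : ∀ y : ℝ → E, LocBddMeas y → LocBddMeas fun s => N s (y s)) {p : ℝ → E}
    (hp : LocBddMeas p) :
    ∃ y : ℝ → E, LocBddMeas y ∧ (∀ t ≤ 0, y t = p t) ∧ Continuous (fun t => y t - p t) ∧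
      ∀ t ∈ Icc 0 T, y t = p t + ∫ s in 0..t, (A (y (s - τ)) - N s (y s)) := by
  -- The continuous part `y - p`, extended by constants, is the fixed point of an integral operator
  -- on `C([0, T])`, an iterate of which is a contraction.
  set e : C(Icc 0 T, E) → ℝ → E := fun Y t => p t + IccExtend hT Y t with he
  have hem : ∀ Y, LocBddMeas (e Y) := fun Y =>
    hp.add (LocBddMeas.of_continuous (Y.continuous.Icc_extend' (h := hT)))
  set k : C(Icc 0 T, E) → ℝ → E := fun Y s => A (e Y (s - τ)) - N s (e Y s) with hk
  have hkm : ∀ Y, LocBddMeas (k Y) := fun Y =>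
    (((hem Y).comp_sub_right τ).clm A).sub (hNm _ (hem Y))
  let Φ : C(Icc 0 T, E) → C(Icc 0 T, E) := fun Y =>
    ⟨fun t => ∫ s in 0..(t : ℝ), k Y s,
      ((hkm Y).continuous_integral 0).comp continuous_subtype_val⟩
  set L := ‖A‖ + K with hL
  have hL0 : 0 ≤ L := by positivity
  have hiter : ∀ (m : ℕ) (Y Z : C(Icc 0 T, E)) (t : Icc 0 T),
      ‖(Φ^[m] Y) t - (Φ^[m] Z) t‖ ≤ (L * t) ^ m / m.factorial * dist Y Z := by
    intro m
    induction m with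
    | zero => intro Y Z t; simpa [dist_eq_norm] using (Y - Z).norm_coe_le_norm t
    | succ m ih =>
      intro Y Z t
      rw [Function.iterate_succ_apply', Function.iterate_succ_apply']
      set Y' := Φ^[m] Y
      set Z' := Φ^[m] Z
      have hd : ∀ s ≤ (t : ℝ), 0 ≤ s → ∀ r ≤ s,
          ‖e Y' r - e Z' r‖ ≤ (L * s) ^ m / m.factorial * dist Y Z := by
        intro s hst hs0 r hr
        have h1 : e Y' r - e Z' r = Y' (projIcc 0 T hT r) - Z' (projIcc 0 T hT r) := by
          simp [he, IccExtend]
        rw [h1]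
        refine (ih Y Z _).trans ?_
        have h2 : ((projIcc 0 T hT r : Icc 0 T) : ℝ) ≤ s := by
          rw [coe_projIcc]
          exact max_le hs0 ((min_le_right _ _).trans hr)
        have h3 : (0 : ℝ) ≤ (projIcc 0 T hT r : Icc 0 T) := (projIcc 0 T hT r).2.1
        gcongr
      have h4 : (Φ Y') t - (Φ Z') t = ∫ s in 0..(t : ℝ), (k Y' s - k Z' s) :=
        (intervalIntegral.integral_sub ((hkm _).intervalIntegrable _ _)
          ((hkm _).intervalIntegrable _ _)).symm
      rw [h4]
      have h5 : ‖∫ s in 0..(t : ℝ), (k Y' s - k Z' s)‖ ≤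
          ∫ s in 0..(t : ℝ), L * ((L * s) ^ m / m.factorial * dist Y Z) := by
        refine intervalIntegral.norm_integral_le_of_norm_le t.2.1 ?_
          (Continuous.intervalIntegrable (by fun_prop) _ _)
        refine Eventually.of_forall fun s hs => ?_
        have h6 : k Y' s - k Z' s = A (e Y' (s - τ) - e Z' (s - τ)) -
            (N s (e Y' s) - N s (e Z' s)) := by
          simp only [hk, map_sub]; abel
        rw [h6, hL, add_mul]
        refine (norm_sub_le _ _).trans (add_le_add ?_ ?_)
        · exact (A.le_opNorm _).trans (mul_le_mul_of_nonneg_left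
            (hd s hs.2 hs.1.le _ (by linarith)) (norm_nonneg _))
        · exact (hN _ _ _).trans (mul_le_mul_of_nonneg_left (hd s hs.2 hs.1.le _ le_rfl) hK)
      refine h5.trans (le_of_eq ?_)
      have h7 : (fun s : ℝ => L * ((L * s) ^ m / m.factorial * dist Y Z)) =
          fun s => (L ^ (m + 1) / m.factorial * dist Y Z) * s ^ m := by
        ext s
        rw [mul_pow]
        ring
      rw [h7, intervalIntegral.integral_const_mul, integral_pow, Nat.factorial_succ,
        zero_pow (Nat.succ_ne_zero m), sub_zero, mul_pow]
      push_cast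
      field_simp
  obtain ⟨m, hm⟩ : ∃ m : ℕ, (L * T) ^ m / m.factorial < 1 :=
    ((FloorSemiring.tendsto_pow_div_factorial_atTop (L * T)).eventually_lt_const one_pos).exists
  obtain ⟨c, hcm⟩ : ∃ c : NNReal, (c : ℝ) = (L * T) ^ m / m.factorial :=
    ⟨⟨_, by positivity⟩, rfl⟩
  have hc : ContractingWith c Φ^[m] := by
    refine ⟨by rw [← hcm] at hm; exact_mod_cast hm, LipschitzWith.of_dist_le_mul fun Y Z => ?_⟩
    rw [ContinuousMap.dist_le (by positivity)]
    intro t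
    rw [dist_eq_norm]
    refine (hiter m Y Z t).trans ?_
    have := t.2.1
    have := t.2.2
    rw [hcm]
    gcongr
  have hfix := hc.isFixedPt_fixedPoint_iterate
  set Y := ContractingWith.fixedPoint (Φ^[m]) hc
  have hY : ∀ t : Icc 0 T, Y t = ∫ s in 0..(t : ℝ), k Y s := fun t =>
    (congrArg (fun Z : C(Icc 0 T, E) => Z t) hfix).symm
  refine ⟨e Y, hem Y, fun t ht => ?_, ?_, fun t ht => ?_⟩
  · have : IccExtend hT Y t = 0 := by
      rw [IccExtend_of_le_left _ _ ht, hY]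
      simp
    simp only [he, this, add_zero]
  · simpa [he] using Y.continuous.Icc_extend' (h := hT)
  · have : IccExtend hT Y t = ∫ s in 0..t, k Y s := by
      rw [IccExtend_of_mem _ _ ht, hY]
    rw [← this]

/-- Bounded convergence in `L²`: on a finite measure space, functions that stay bounded and
converge almost everywhere converge in `L²`. -/
lemma tendsto_Lp_two_of_bounded {ι Ω E : Type*} [NormedAddCommGroup E] [MeasurableSpace Ω]
    {μ : Measure Ω} [IsFiniteMeasure μ] {l : Filter ι} [l.IsCountablyGenerated] {Z : ι → Lp E 2 μ}
    {Z₀ : Lp E 2 μ}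
    {z : ι → Ω → E} {z₀ : Ω → E} {C : ℝ} (hZ : ∀ᶠ i in l, Z i =ᵐ[μ] z i) (hZ₀ : Z₀ =ᵐ[μ] z₀)
    (hb : ∀ᶠ i in l, ∀ᵐ t ∂μ, ‖z i t‖ ≤ C) (hb₀ : ∀ᵐ t ∂μ, ‖z₀ t‖ ≤ C)
    (hlim : ∀ᵐ t ∂μ, Tendsto (fun i => z i t) l (𝓝 (z₀ t))) : Tendsto Z l (𝓝 Z₀) := by
  rw [Lp.tendsto_Lp_iff_tendsto_eLpNorm']
  have h1 : Tendsto (fun i => ∫ t, ‖(z i - z₀) t‖ ^ (2 : ℝ) ∂μ) l (𝓝 (∫ _, 0 ∂μ)) := by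
    refine tendsto_integral_filter_of_dominated_convergence (fun _ => (C + C) ^ (2 : ℝ)) ?_ ?_
      (integrable_const _) ?_
    · filter_upwards [hZ] with i hi
      exact (((((Lp.aestronglyMeasurable (Z i)).congr hi).sub
        ((Lp.aestronglyMeasurable Z₀).congr
          hZ₀)).norm.aemeasurable).pow_const _).aestronglyMeasurable
    · filter_upwards [hb] with i hi
      filter_upwards [hi, hb₀] with t h h0
      rw [Real.norm_of_nonneg (by positivity)]
      exact Real.rpow_le_rpow (norm_nonneg _) ((norm_sub_le _ _).trans (add_le_add h h0))
        (by norm_num)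
    · filter_upwards [hlim] with t ht
      simpa using (ht.sub_const (z₀ t)).norm.rpow_const (p := 2) (Or.inr (by norm_num))
  rw [integral_zero] at h1
  have h2 := ENNReal.tendsto_ofReal (h1.rpow_const (p := (2 : ℝ)⁻¹) (Or.inr (by norm_num)))
  rw [Real.zero_rpow (by norm_num), ENNReal.ofReal_zero] at h2
  refine h2.congr' ?_
  filter_upwards [hZ] with i hi
  have h3 : (Z i : Ω → E) - (Z₀ : Ω → E) =ᵐ[μ] z i - z₀ := hi.sub hZ₀
  rw [eLpNorm_congr_ae h3, MemLp.eLpNorm_eq_integral_rpow_norm (by norm_num) (by norm_num)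
    (((Lp.memLp (Z i)).sub (Lp.memLp Z₀)).ae_eq h3)]
  simp

/-- Pointwise differentiability with respect to a parameter at almost every time, together with a
uniform Lipschitz bound, gives differentiability as a map into `L²`. -/
lemma hasDerivWithinAt_Lp_two {Ω : Type*} [MeasurableSpace Ω] {μ : Measure Ω}
    [IsFiniteMeasure μ] {S : Set ℝ} {X : ℝ → Lp E 2 μ} {W : Lp E 2 μ} {x : ℝ → Ω → E}
    {w : Ω → E} {C τ : ℝ} (hX : ∀ σ ∈ S, X σ =ᵐ[μ] x σ) (hτ : τ ∈ S) (hW : W =ᵐ[μ] w)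
    (hb : ∀ σ ∈ S, ∀ᵐ t ∂μ, ‖x σ t - x τ t‖ ≤ C * |σ - τ|) (hb₀ : ∀ᵐ t ∂μ, ‖w t‖ ≤ C)
    (hlim : ∀ᵐ t ∂μ, HasDerivWithinAt (fun σ => x σ t) (w t) S τ) :
    HasDerivWithinAt X W S τ := by
  rw [hasDerivWithinAt_iff_tendsto_slope]
  refine tendsto_Lp_two_of_bounded (z := fun σ t => slope (fun σ => x σ t) τ σ) (z₀ := w) (C := C)
    ?_ hW ?_ hb₀ ?_
  · filter_upwards [self_mem_nhdsWithin] with σ hσ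
    rw [slope_def_module]
    filter_upwards [Lp.coeFn_smul (σ - τ)⁻¹ (X σ - X τ), Lp.coeFn_sub (X σ) (X τ), hX σ hσ.1,
      hX τ hτ] with t h1 h2 h3 h4
    rw [h1, Pi.smul_apply, h2, Pi.sub_apply, h3, h4, slope_def_module]
  · filter_upwards [self_mem_nhdsWithin] with σ hσ
    filter_upwards [hb σ hσ.1] with t ht
    have hne : 0 < |σ - τ| := abs_pos.mpr (sub_ne_zero.mpr hσ.2)
    rw [slope_def_module, norm_smul, norm_inv, Real.norm_eq_abs, inv_mul_le_iff₀ hne]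
    linarith
  · filter_upwards [hlim] with t ht
    exact hasDerivWithinAt_iff_tendsto_slope.mp ht

end Delay

/-! ### Differentiation with respect to the delay -/

/-- A uniform bound on slopes from a Lipschitz bound. -/
lemma norm_slope_le {F : Type*} [NormedAddCommGroup F] [NormedSpace ℝ F] {u : ℝ → F} {c σ τ : ℝ}
    (hne : σ ≠ τ) (hu : ‖u σ - u τ‖ ≤ c * |σ - τ|) : ‖slope u τ σ‖ ≤ c := by
  have hpos : 0 < |σ - τ| := abs_pos.mpr (sub_ne_zero.mpr hne)
  rw [slope_def_module, norm_smul, norm_inv, Real.norm_eq_abs, inv_mul_le_iff₀ hpos]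
  linarith

section Delay

variable {E : Type*} [NormedAddCommGroup E] [NormedSpace ℝ E]

/-- Differentiation of the delay equation with respect to the delay. The difference quotients of
`y σ` minus `dy` solve a perturbed equation in which the shift of `y τ` enters only through
difference quotients of its primitive, so that no time derivative of `y τ` is needed. -/
lemma delay_hasDerivWithinAt [CompleteSpace E] {A : E →L[ℝ] E} {b T C K τ : ℝ} (hT : 0 ≤ T)
    (hK : 0 ≤ K) (hτ : τ ∈ Icc 0 b) {Z : Set ℝ} (hZ : Z.Countable) {y q n : ℝ → ℝ → E}
    {dy dq dn : ℝ → E} {κ : ℝ → ℝ → ℝ}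
    (hy : ∀ σ ∈ Icc 0 b, LocBddMeas (y σ)) (hyc : Continuous (y τ))
    (hy0 : ∀ σ ∈ Icc 0 b, ∀ t ≤ 0, y σ t = y τ t)
    (hq : ∀ σ ∈ Icc 0 b, LocBddMeas (q σ)) (hn : ∀ σ ∈ Icc 0 b, LocBddMeas (n σ))
    (heq : ∀ σ ∈ Icc 0 b, ∀ t ∈ Ioc 0 T,
      y σ t = q σ t + ∫ s in 0..t, (A (y σ (s - σ)) - n σ s))
    (hdy : LocBddMeas dy) (hdy0 : ∀ t ≤ 0, dy t = 0) (hdq : LocBddMeas dq) (hdn : LocBddMeas dn)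
    (hdeq : ∀ t ∈ Ioc 0 T, dy t = (dq t - A (y τ (t - τ) - y τ (-τ))) +
      ∫ s in 0..t, (A (dy (s - τ)) - dn s))
    (hκ : ∀ σ ∈ Icc 0 b, σ ≠ τ → LocBddMeas (κ σ) ∧ (∀ s, 0 ≤ κ σ s) ∧
      (∀ s ∈ Ioc 0 T, κ σ s ≤ C) ∧ ∀ s ∈ Icc 0 T, ‖slope (fun σ => n σ s) τ σ - dn s‖ ≤
        K * ‖slope (fun σ => y σ s) τ σ - dy s‖ + κ σ s)
    (hqb : ∀ σ ∈ Icc 0 b, ∀ t ∈ Ioc 0 T, ‖q σ t - q τ t‖ ≤ C * |σ - τ|)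
    (hκlim : ∀ t ∈ Ioc 0 T, t ∉ Z → Tendsto (fun σ => κ σ t) (𝓝[Icc 0 b \ {τ}] τ) (𝓝 0))
    (hqlim : ∀ t ∈ Ioc 0 T, t ∉ Z → HasDerivWithinAt (fun σ => q σ t) (dq t) (Icc 0 b) τ) :
    ∀ t ∈ Ioc 0 T, t ∉ Z → HasDerivWithinAt (fun σ => y σ t) (dy t) (Icc 0 b) τ := by
  obtain ⟨Cy, hCy⟩ := (hy τ hτ).exists_bound_Icc (-b) T
  obtain ⟨Cd, hCd⟩ := hdy.exists_bound_Icc (-b) T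
  obtain ⟨Cq, hCq⟩ := hdq.exists_bound_Icc 0 T
  set Q : ℝ → E := fun r => ∫ s in 0..r, y τ s with hQ
  set D : ℝ → E := fun r => ∫ s in 0..r, dy s with hD
  have hQc : Continuous Q := (hy τ hτ).continuous_integral 0
  have hDc : Continuous D := hdy.continuous_integral 0
  have hQd : ∀ r, HasDerivAt Q (y τ r) r := fun r =>
    intervalIntegral.integral_hasDerivAt_right (hyc.intervalIntegrable _ _)
      hyc.stronglyMeasurable.stronglyMeasurableAtFilter hyc.continuousAt
  have hQs : ∀ t, HasDerivAt (fun σ => Q (t - σ)) (-(y τ (t - τ))) τ := fun t =>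
    (hQd (t - τ)).comp_const_sub t τ
  have hmem : ∀ σ ∈ Icc 0 b, ∀ t ∈ Icc 0 T, t - σ ∈ Icc (-b) T := fun σ hσ t ht =>
    ⟨by linarith [hσ.2, ht.1], by linarith [hσ.1, ht.2]⟩
  have hmem0 : ∀ σ ∈ Icc 0 b, -σ ∈ Icc (-b) T := fun σ hσ =>
    ⟨by linarith [hσ.2], by linarith [hσ.1]⟩
  set z : ℝ → ℝ → E := fun σ t => slope (fun σ => y σ t) τ σ - dy t with hz
  set a : ℝ → ℝ → E := fun σ t => (slope (fun σ => q σ t) τ σ - dq t) +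
    A (((D (t - σ) - D (t - τ)) - (D (-σ) - D (-τ))) +
      ((slope (fun σ => Q (t - σ)) τ σ + y τ (t - τ)) -
        (slope (fun σ => Q (-σ)) τ σ + y τ (-τ)))) with ha
  set k : ℝ → ℝ → E := fun σ s => slope (fun σ => n σ s) τ σ - dn s with hk
  have hslope : ∀ {u : ℝ → ℝ → E}, (∀ σ ∈ Icc 0 b, LocBddMeas (u σ)) → ∀ σ ∈ Icc 0 b,
      LocBddMeas fun t => slope (fun σ => u σ t) τ σ := fun hu σ hσ => by
    simp only [slope_def_module]
    exact ((hu σ hσ).sub (hu τ hτ)).const_smul _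
  have hCy0 : 0 ≤ Cy := (norm_nonneg _).trans (hCy _ (hmem0 τ hτ))
  have hCd0 : 0 ≤ Cd := (norm_nonneg _).trans (hCd _ (hmem0 τ hτ))
  have hQle : ∀ σ ∈ Icc 0 b, ∀ r ∈ Icc 0 T, ‖Q (r - σ) - Q (r - τ)‖ ≤ Cy * |σ - τ| := by
    intro σ hσ r hr
    have := norm_primitive_sub_le (hy τ hτ) hCy (hmem σ hσ r hr) (hmem τ hτ r hr)
    rwa [sub_sub_sub_cancel_left, abs_sub_comm τ σ] at this
  have hDle : ∀ σ ∈ Icc 0 b, ∀ r ∈ Icc 0 T, ‖D (r - σ) - D (r - τ)‖ ≤ Cd * b := by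
    intro σ hσ r hr
    refine (norm_primitive_sub_le hdy hCd (hmem σ hσ r hr) (hmem τ hτ r hr)).trans ?_
    gcongr
    rw [sub_sub_sub_cancel_left, abs_le]
    constructor <;> linarith [hσ.1, hσ.2, hτ.1, hτ.2]
  have key := delay_tendsto_zero (A := A) (l := 𝓝[Icc 0 b \ {τ}] τ) (z := z) (a := a) (k := k)
    (κ := κ) (K := K) (T := T)
    (C := max C (C + Cq + ‖A‖ * ((Cd * b + Cd * b) + ((Cy + Cy) + (Cy + Cy))))) (Z := Z) hZ hK ?_ ?_
    hκlim
  · intro t ht htZ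
    rw [hasDerivWithinAt_iff_tendsto_slope]
    simpa [hz] using (key t ht htZ).add_const (dy t)
  · filter_upwards [self_mem_nhdsWithin] with σ hσ
    have hne : σ ≠ τ := hσ.2
    obtain ⟨h1, h2, h3, h4⟩ := hκ σ hσ.1 hne
    refine ⟨hσ.1.1, (hslope hy σ hσ.1).sub hdy, fun t ht => ?_, ?_, h1, h2, h4, fun t ht => ?_,
      fun t ht => ?_, fun t ht => (h3 t ht).trans (le_max_left _ _)⟩
    · simp [hz, slope_def_module, hy0 σ hσ.1 t ht, hdy0 t ht]
    · refine ((hslope hq σ hσ.1).sub hdq).add (LocBddMeas.clm A (((((LocBddMeas.of_continuous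
        hDc).comp_sub_right σ).sub ((LocBddMeas.of_continuous hDc).comp_sub_right τ)).sub
        (LocBddMeas.const _)).add (LocBddMeas.sub (LocBddMeas.add ?_
        ((hy τ hτ).comp_sub_right τ)) (LocBddMeas.const _))))
      simp only [slope_def_module]
      exact (((LocBddMeas.of_continuous hQc).comp_sub_right σ).sub
        ((LocBddMeas.of_continuous hQc).comp_sub_right τ)).const_smul _
    · have e1 := heq σ hσ.1 t ht
      have e2 := heq τ hτ t ht
      have e3 := hdeq t ht
      rw [integral_delay A (hy σ hσ.1) (hn σ hσ.1)] at e1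
      rw [integral_delay A (hy τ hτ) (hn τ hτ)] at e2
      rw [integral_delay A hdy hdn] at e3
      have hi : ∀ {u : ℝ → ℝ → E}, (∀ σ ∈ Icc 0 b, LocBddMeas (u σ)) → ∀ {du : ℝ → E},
          LocBddMeas du → ∀ r, ∫ s in 0..r, (slope (fun σ => u σ s) τ σ - du s) =
            (σ - τ)⁻¹ • ((∫ s in 0..r, u σ s) - ∫ s in 0..r, u τ s) - ∫ s in 0..r, du s := by
        intro u hu du hdu r
        rw [intervalIntegral.integral_sub ((hslope hu σ hσ.1).intervalIntegrable _ _)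
          (hdu.intervalIntegrable _ _)]
        simp only [slope_def_module]
        rw [intervalIntegral.integral_smul, intervalIntegral.integral_sub
          ((hu σ hσ.1).intervalIntegrable _ _) ((hu τ hτ).intervalIntegrable _ _)]
      rw [integral_delay A ((hslope hy σ hσ.1).sub hdy) ((hslope hn σ hσ.1).sub hdn),
        hi hy hdy, hi hy hdy, hi hn hdn]
      simp only [hz, ha, slope_def_module, hQ, hD]
      rw [e1, e2, e3]
      simp only [map_sub, map_add, map_smul]
      module
    · refine le_trans ?_ (le_max_right _ _)
      have ht' : t ∈ Icc 0 T := ⟨ht.1.le, ht.2⟩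
      have h0 : (0 : ℝ) ∈ Icc 0 T := ⟨le_rfl, hT⟩
      refine (norm_add_le _ _).trans (add_le_add ((norm_sub_le _ _).trans (add_le_add ?_
        (hCq t ht'))) ((A.le_opNorm _).trans (mul_le_mul_of_nonneg_left ?_ (norm_nonneg _))))
      · exact norm_slope_le hne (hqb σ hσ.1 t ht)
      refine (norm_add_le _ _).trans (add_le_add ((norm_sub_le _ _).trans (add_le_add
        (hDle σ hσ.1 t ht') (by simpa using hDle σ hσ.1 0 h0))) ((norm_sub_le _ _).trans
        (add_le_add ((norm_add_le _ _).trans (add_le_add ?_ (hCy _ (hmem τ hτ t ht'))))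
          ((norm_add_le _ _).trans (add_le_add ?_ (hCy _ (hmem0 τ hτ)))))))
      · exact norm_slope_le hne (hQle σ hσ.1 t ht')
      · exact norm_slope_le hne (by simpa using hQle σ hσ.1 0 h0)
  · intro t ht htZ
    have hl : 𝓝[Icc 0 b \ {τ}] τ ≤ 𝓝 τ := nhdsWithin_le_nhds
    have h1 := (hasDerivWithinAt_iff_tendsto_slope.mp (hqlim t ht htZ)).sub_const (dq t)
    have hsl : ∀ r, Tendsto (slope (fun σ => Q (r - σ)) τ) (𝓝[Icc 0 b \ {τ}] τ)
        (𝓝 (-(y τ (r - τ)))) := fun r =>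
      hasDerivWithinAt_iff_tendsto_slope.mp (hQs r).hasDerivWithinAt
    have h2 : ∀ r, Tendsto (fun σ => D (r - σ) - D (r - τ)) (𝓝[Icc 0 b \ {τ}] τ) (𝓝 0) :=
        fun r => by
      have : Continuous fun σ => D (r - σ) - D (r - τ) := by fun_prop
      simpa using (this.tendsto τ).mono_left hl
    have h3 := ((h2 t).sub (h2 0)).add (((hsl t).add_const (y τ (t - τ))).sub
      ((hsl 0).add_const (y τ (0 - τ))))
    simpa [ha] using h1.add ((A.continuous.tendsto _).comp h3)

end Delay

section Family

variable {E : Type*} [NormedAddCommGroup E] [NormedSpace ℝ E]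

/-! ### The family of solutions and of its formal derivatives -/

/-- The solutions `x σ` of the delay equation for all delays `σ ∈ [0, b]`, together with the time
derivative `xt σ` and the candidates `w σ`, `v σ` for the first and second derivative with respect
to the delay. All equations are in integrated form, where the derivatives of the shifted functions
in time are already integrated; in particular the impulse of the equation for `v σ` is the jump of
`xt σ` at zero. The nonlinearity and its derivatives are globally bounded. -/
structure SensitivityFamily (A : E →L[ℝ] E) (b T K R : ℝ) (f : E → E) (φ φt g : ℝ → E)
    (x xt w v : ℝ → ℝ → E) : Prop where
  b_nonneg : 0 ≤ b
  T_nonneg : 0 ≤ T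
  f_contDiff : ContDiff ℝ 2 f
  f_le : ∀ p, ‖f p‖ ≤ K
  fderiv_le : ∀ p, ‖fderiv ℝ f p‖ ≤ K
  fderiv_fderiv_le : ∀ p, ‖fderiv ℝ (fderiv ℝ f) p‖ ≤ K
  φt_cont : Continuous φt
  φ_eq : ∀ t ∈ Icc (-b) 0, φ t = φ 0 + ∫ s in 0..t, φt s
  g_cont : Continuous g
  x_cont : ∀ σ ∈ Icc 0 b, Continuous (x σ)
  x_le : ∀ σ ∈ Icc 0 b, ∀ t ∈ Icc (-b) T, ‖x σ t‖ ≤ R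
  x_hist : ∀ σ ∈ Icc 0 b, ∀ t ≤ 0, x σ t = φ t
  x_eq : ∀ σ ∈ Icc 0 b, ∀ t ∈ Ioc 0 T,
    x σ t = φ 0 + ∫ s in 0..t, (A (x σ (s - σ)) - (f (x σ s) - g s))
  xt_eq : ∀ σ t, xt σ t = if t < 0 then φt t else A (x σ (t - σ)) - (f (x σ t) - g t)
  w_cont : ∀ σ ∈ Icc 0 b, Continuous (w σ)
  w_hist : ∀ σ ∈ Icc 0 b, ∀ t ≤ 0, w σ t = 0
  w_eq : ∀ σ ∈ Icc 0 b, ∀ t ∈ Ioc 0 T, w σ t = -A (x σ (t - σ) - φ (-σ)) +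
    ∫ s in 0..t, (A (w σ (s - σ)) - fderiv ℝ f (x σ s) (w σ s))
  v_meas : ∀ σ ∈ Icc 0 b, LocBddMeas (v σ)
  v_hist : ∀ σ ∈ Icc 0 b, ∀ t ≤ 0, v σ t = 0
  v_eq : ∀ σ ∈ Icc 0 b, ∀ t ∈ Ioc 0 T,
    v σ t = (A (xt σ (t - σ) - φt (-σ)) - (2 : ℝ) • A (w σ (t - σ))) +
      ∫ s in 0..t, (A (v σ (s - σ)) - (fderiv ℝ f (x σ s) (v σ s) +
        fderiv ℝ (fderiv ℝ f) (x σ s) (w σ s) (w σ s)))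

namespace SensitivityFamily

variable {A : E →L[ℝ] E} {b T K R : ℝ} {f : E → E} {φ φt g : ℝ → E} {x xt w v : ℝ → ℝ → E}

lemma K_nonneg (h : SensitivityFamily A b T K R f φ φt g x xt w v) : 0 ≤ K :=
  (norm_nonneg _).trans (h.f_le 0)

lemma sub_mem (_h : SensitivityFamily A b T K R f φ φt g x xt w v) {σ t : ℝ}
    (hσ : σ ∈ Icc 0 b) (ht : t ∈ Icc 0 T) : t - σ ∈ Icc (-b) T :=
  ⟨by linarith [hσ.2, ht.1], by linarith [hσ.1, ht.2]⟩

lemma neg_mem (h : SensitivityFamily A b T K R f φ φt g x xt w v) {σ : ℝ}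
    (hσ : σ ∈ Icc 0 b) : -σ ∈ Icc (-b) T :=
  ⟨by linarith [hσ.2], by linarith [hσ.1, h.T_nonneg]⟩

lemma mem_of_mem (h : SensitivityFamily A b T K R f φ φt g x xt w v) {t : ℝ}
    (ht : t ∈ Icc 0 T) : t ∈ Icc (-b) T :=
  ⟨by linarith [h.b_nonneg, ht.1], ht.2⟩

lemma R_nonneg (h : SensitivityFamily A b T K R f φ φt g x xt w v) : 0 ≤ R :=
  (norm_nonneg _).trans (h.x_le 0 ⟨le_rfl, h.b_nonneg⟩ 0 (h.mem_of_mem ⟨le_rfl, h.T_nonneg⟩))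

lemma f_differentiable (h : SensitivityFamily A b T K R f φ φt g x xt w v) :
    Differentiable ℝ f := h.f_contDiff.differentiable (by norm_num)

lemma contDiff_fderiv (h : SensitivityFamily A b T K R f φ φt g x xt w v) :
    ContDiff ℝ 1 (fderiv ℝ f) := h.f_contDiff.fderiv_right (by norm_num)

lemma fderiv_differentiable (h : SensitivityFamily A b T K R f φ φt g x xt w v) :
    Differentiable ℝ (fderiv ℝ f) := h.contDiff_fderiv.differentiable (by norm_num)

lemma fderiv_fderiv_cont (h : SensitivityFamily A b T K R f φ φt g x xt w v) :
    Continuous (fderiv ℝ (fderiv ℝ f)) := h.contDiff_fderiv.continuous_fderiv (by norm_num)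

lemma f_lipschitz (h : SensitivityFamily A b T K R f φ φt g x xt w v) (p q : E) :
    ‖f p - f q‖ ≤ K * ‖p - q‖ :=
  convex_univ.norm_image_sub_le_of_norm_fderiv_le (fun r _ => h.f_differentiable r)
    (fun r _ => h.fderiv_le r) (mem_univ q) (mem_univ p)

lemma fderiv_lipschitz (h : SensitivityFamily A b T K R f φ φt g x xt w v) (p q : E) :
    ‖fderiv ℝ f p - fderiv ℝ f q‖ ≤ K * ‖p - q‖ :=
  convex_univ.norm_image_sub_le_of_norm_fderiv_le (fun r _ => h.fderiv_differentiable r)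
    (fun r _ => h.fderiv_fderiv_le r) (mem_univ q) (mem_univ p)

section Measurability

variable {σ : ℝ} (hσ : σ ∈ Icc 0 b)
include hσ

lemma x_meas (h : SensitivityFamily A b T K R f φ φt g x xt w v) : LocBddMeas (x σ) :=
  .of_continuous (h.x_cont σ hσ)

lemma w_meas (h : SensitivityFamily A b T K R f φ φt g x xt w v) : LocBddMeas (w σ) :=
  .of_continuous (h.w_cont σ hσ)

lemma xt_pos_cont (h : SensitivityFamily A b T K R f φ φt g x xt w v) :
    Continuous fun t => A (x σ (t - σ)) - (f (x σ t) - g t) := by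
  have := h.x_cont σ hσ
  have := h.f_contDiff.continuous
  have := h.g_cont
  fun_prop

lemma xt_meas (h : SensitivityFamily A b T K R f φ φt g x xt w v) : LocBddMeas (xt σ) := by
  have := LocBddMeas.ite (p := fun t : ℝ => t < 0) measurableSet_Iio
    (.of_continuous h.φt_cont) (.of_continuous (h.xt_pos_cont hσ))
  convert this using 2 with t
  exact h.xt_eq σ t

lemma force_x_meas (h : SensitivityFamily A b T K R f φ φt g x xt w v) :
    LocBddMeas fun s => f (x σ s) - g s :=
  .of_continuous ((h.f_contDiff.continuous.comp (h.x_cont σ hσ)).sub h.g_cont)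

lemma fderiv_x_meas (h : SensitivityFamily A b T K R f φ φt g x xt w v) :
    LocBddMeas fun s => fderiv ℝ f (x σ s) :=
  .of_continuous (h.contDiff_fderiv.continuous.comp (h.x_cont σ hσ))

lemma force_w_meas (h : SensitivityFamily A b T K R f φ φt g x xt w v) :
    LocBddMeas fun s => fderiv ℝ f (x σ s) (w σ s) :=
  (h.fderiv_x_meas hσ).clm_apply (h.w_meas hσ)

lemma quad_meas (h : SensitivityFamily A b T K R f φ φt g x xt w v) :
    LocBddMeas fun s => fderiv ℝ (fderiv ℝ f) (x σ s) (w σ s) (w σ s) :=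
  ((LocBddMeas.of_continuous (h.fderiv_fderiv_cont.comp (h.x_cont σ hσ))).clm_apply
    (h.w_meas hσ)).clm_apply (h.w_meas hσ)

lemma force_v_meas (h : SensitivityFamily A b T K R f φ φt g x xt w v) :
    LocBddMeas fun s => fderiv ℝ f (x σ s) (v σ s) +
        fderiv ℝ (fderiv ℝ f) (x σ s) (w σ s) (w σ s) :=
  ((h.fderiv_x_meas hσ).clm_apply (h.v_meas σ hσ)).add (h.quad_meas hσ)

lemma impulse_meas (h : SensitivityFamily A b T K R f φ φt g x xt w v) :
    LocBddMeas fun t => A (xt σ (t - σ) - φt (-σ)) - (2 : ℝ) • A (w σ (t - σ)) :=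
  (LocBddMeas.clm A (((h.xt_meas hσ).comp_sub_right σ).sub (.const _))).sub
    ((((h.w_meas hσ).comp_sub_right σ).clm A).const_smul 2)

lemma w_time_meas (h : SensitivityFamily A b T K R f φ φt g x xt w v) :
    LocBddMeas fun t => A (w σ (t - σ)) - fderiv ℝ f (x σ t) (w σ t) - A (xt σ (t - σ)) :=
  ((((h.w_meas hσ).comp_sub_right σ).clm A).sub (h.force_w_meas hσ)).sub
    (((h.xt_meas hσ).comp_sub_right σ).clm A)

end Measurability

/-! ### Bounds that are uniform in the delay -/

lemma exists_xt_le (h : SensitivityFamily A b T K R f φ φt g x xt w v) :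
    ∃ C, 0 ≤ C ∧ ∀ σ ∈ Icc 0 b, ∀ t ∈ Icc (-b) T, ‖xt σ t‖ ≤ C := by
  obtain ⟨C₁, h₁⟩ := (LocBddMeas.of_continuous h.φt_cont).exists_bound_Icc (-b) T
  obtain ⟨C₂, h₂⟩ := (LocBddMeas.of_continuous h.g_cont).exists_bound_Icc (-b) T
  have hK := h.K_nonneg
  have hR := h.R_nonneg
  have h0 := h.neg_mem ⟨le_rfl, h.b_nonneg⟩
  have hC₁ : 0 ≤ C₁ := (norm_nonneg _).trans (h₁ _ h0)
  have hC₂ : 0 ≤ C₂ := (norm_nonneg _).trans (h₂ _ h0)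
  refine ⟨C₁ + (‖A‖ * R + (K + C₂)), by positivity, fun σ hσ t ht => ?_⟩
  rw [h.xt_eq]
  split_ifs with ht0
  · have := h₁ t ht
    have : 0 ≤ ‖A‖ * R + (K + C₂) := by positivity
    linarith
  · rw [not_lt] at ht0
    have e1 : ‖A (x σ (t - σ)) - (f (x σ t) - g t)‖ ≤ ‖A‖ * R + (K + C₂) :=
      (norm_sub_le _ _).trans (add_le_add ((A.le_opNorm _).trans (mul_le_mul_of_nonneg_left
        (h.x_le σ hσ _ (h.sub_mem hσ ⟨ht0, ht.2⟩)) (norm_nonneg _)))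
        ((norm_sub_le _ _).trans (add_le_add (h.f_le _) (h₂ t ht))))
    linarith

lemma exists_w_le (h : SensitivityFamily A b T K R f φ φt g x xt w v) :
    ∃ C, 0 ≤ C ∧ ∀ σ ∈ Icc 0 b, ∀ t ≤ T, ‖w σ t‖ ≤ C := by
  have hK := h.K_nonneg
  have hR := h.R_nonneg
  have hT := h.T_nonneg
  refine ⟨(1 + (K + ‖A‖) * Real.exp ((K + ‖A‖) * T) * T) * (‖A‖ * (R + R) + T * 0),
    by positivity, fun σ hσ => ?_⟩
  refine delay_bound (a := fun t => -A (x σ (t - σ) - φ (-σ)))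
    (k := fun s => fderiv ℝ f (x σ s) (w σ s)) (h.w_meas hσ) (h.w_hist σ hσ) hσ.1 ?_ hK hT
    (by positivity) le_rfl (fun t ht => ?_) (fun s _ => ?_) (h.w_eq σ hσ)
  · have := h.x_cont σ hσ
    exact .of_continuous (by fun_prop)
  · rw [norm_neg]
    refine (A.le_opNorm _).trans (mul_le_mul_of_nonneg_left ?_ (norm_nonneg _))
    refine (norm_sub_le _ _).trans (add_le_add (h.x_le σ hσ _ (h.sub_mem hσ ⟨ht.1.le, ht.2⟩)) ?_)
    rw [← h.x_hist σ hσ _ (by linarith [hσ.1])]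
    exact h.x_le σ hσ _ (h.neg_mem hσ)
  · rw [add_zero]
    exact ((fderiv ℝ f (x σ s)).le_opNorm _).trans
      (mul_le_mul_of_nonneg_right (h.fderiv_le _) (norm_nonneg _))

lemma norm_quad_le (h : SensitivityFamily A b T K R f φ φt g x xt w v) (p y z : E) :
    ‖fderiv ℝ (fderiv ℝ f) p y z‖ ≤ K * ‖y‖ * ‖z‖ :=
  (ContinuousLinearMap.le_opNorm _ _).trans (mul_le_mul_of_nonneg_right
    ((ContinuousLinearMap.le_opNorm _ _).trans (mul_le_mul_of_nonneg_right
      (h.fderiv_fderiv_le p) (norm_nonneg _))) (norm_nonneg _))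

lemma norm_lin_le (h : SensitivityFamily A b T K R f φ φt g x xt w v) (p y : E) :
    ‖fderiv ℝ f p y‖ ≤ K * ‖y‖ :=
  (ContinuousLinearMap.le_opNorm _ _).trans
    (mul_le_mul_of_nonneg_right (h.fderiv_le _) (norm_nonneg _))

lemma exists_impulse_le (h : SensitivityFamily A b T K R f φ φt g x xt w v) :
    ∃ C, 0 ≤ C ∧ ∀ σ ∈ Icc 0 b, ∀ t ∈ Ioc 0 T,
      ‖A (xt σ (t - σ) - φt (-σ)) - (2 : ℝ) • A (w σ (t - σ))‖ ≤ C := by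
  obtain ⟨C₀, hC₀, h₀⟩ := h.exists_xt_le
  obtain ⟨C₁, h₁⟩ := (LocBddMeas.of_continuous h.φt_cont).exists_bound_Icc (-b) T
  obtain ⟨C₂, hC₂, h₂⟩ := h.exists_w_le
  have hC₁ : 0 ≤ C₁ := (norm_nonneg _).trans (h₁ _ (h.neg_mem ⟨le_rfl, h.b_nonneg⟩))
  refine ⟨‖A‖ * (C₀ + C₁) + 2 * (‖A‖ * C₂), by positivity, fun σ hσ t ht => ?_⟩
  refine (norm_sub_le _ _).trans (add_le_add ((A.le_opNorm _).trans (mul_le_mul_of_nonneg_left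
    ((norm_sub_le _ _).trans (add_le_add (h₀ σ hσ _ (h.sub_mem hσ ⟨ht.1.le, ht.2⟩))
      (h₁ _ (h.neg_mem hσ)))) (norm_nonneg _))) ?_)
  rw [norm_smul, Real.norm_of_nonneg zero_le_two]
  gcongr
  exact (A.le_opNorm _).trans (mul_le_mul_of_nonneg_left (h₂ σ hσ _ (by linarith [hσ.1, ht.2]))
    (norm_nonneg _))

lemma exists_v_le (h : SensitivityFamily A b T K R f φ φt g x xt w v) :
    ∃ C, 0 ≤ C ∧ ∀ σ ∈ Icc 0 b, ∀ t ≤ T, ‖v σ t‖ ≤ C := by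
  obtain ⟨C₁, hC₁, h₁⟩ := h.exists_impulse_le
  obtain ⟨C₂, hC₂, h₂⟩ := h.exists_w_le
  have hK := h.K_nonneg
  have hT := h.T_nonneg
  refine ⟨(1 + (K + ‖A‖) * Real.exp ((K + ‖A‖) * T) * T) * (C₁ + T * (K * C₂ * C₂)),
    by positivity, fun σ hσ => ?_⟩
  refine delay_bound (h.v_meas σ hσ) (h.v_hist σ hσ) hσ.1 (h.impulse_meas hσ) hK hT
    hC₁ (by positivity) (h₁ σ hσ) (fun s hs => ?_) (h.v_eq σ hσ)
  have := h₂ σ hσ s hs.2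
  refine (norm_add_le _ _).trans (add_le_add (h.norm_lin_le _ _) ((h.norm_quad_le _ _ _).trans ?_))
  gcongr

end SensitivityFamily

end Family

namespace SensitivityFamily

variable {E : Type*} [NormedAddCommGroup E] [NormedSpace ℝ E]
variable {A : E →L[ℝ] E} {b T K R : ℝ} {f : E → E} {φ φt g : ℝ → E} {x xt w v : ℝ → ℝ → E}

/-! ### Lipschitz bounds in time and in the delay -/

/-- `xt σ` is the time derivative of `x σ`, on both sides of zero. -/
lemma x_eq_primitive (h : SensitivityFamily A b T K R f φ φt g x xt w v) {σ t : ℝ}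
    (hσ : σ ∈ Icc 0 b) (ht : t ∈ Icc (-b) T) : x σ t = φ 0 + ∫ s in 0..t, xt σ s := by
  rcases le_or_gt t 0 with ht0 | ht0
  · rw [h.x_hist σ hσ t ht0, h.φ_eq t ⟨ht.1, ht0⟩]
    congr 1
    refine intervalIntegral.integral_congr_ae ?_
    filter_upwards [Measure.ae_ne volume 0] with s hs hs'
    rw [uIoc_of_ge ht0] at hs'
    rw [h.xt_eq, if_pos (lt_of_le_of_ne hs'.2 hs)]
  · rw [h.x_eq σ hσ t ⟨ht0, ht.2⟩]
    congr 1
    refine intervalIntegral.integral_congr fun s hs => ?_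
    rw [uIcc_of_le ht0.le] at hs
    simp only [h.xt_eq, if_neg (not_lt.mpr hs.1)]

lemma x_sub_eq (h : SensitivityFamily A b T K R f φ φt g x xt w v) {σ t s : ℝ}
    (hσ : σ ∈ Icc 0 b) (ht : t ∈ Icc (-b) T) (hs : s ∈ Icc (-b) T) :
    x σ t - x σ s = (∫ r in 0..t, xt σ r) - ∫ r in 0..s, xt σ r := by
  rw [h.x_eq_primitive hσ ht, h.x_eq_primitive hσ hs, add_sub_add_left_eq_sub]

lemma exists_x_time_lipschitz (h : SensitivityFamily A b T K R f φ φt g x xt w v) :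
    ∃ C, 0 ≤ C ∧ ∀ σ ∈ Icc 0 b, ∀ t ∈ Icc (-b) T, ∀ s ∈ Icc (-b) T,
      ‖x σ t - x σ s‖ ≤ C * |t - s| := by
  obtain ⟨C, hC, hb⟩ := h.exists_xt_le
  refine ⟨C, hC, fun σ hσ t ht s hs => ?_⟩
  rw [h.x_sub_eq hσ ht hs]
  exact norm_primitive_sub_le (h.xt_meas hσ) (hb σ hσ) ht hs

/-- The error caused by changing the delay in a fixed function is of the order of the change. -/
lemma norm_shift_primitive_le (h : SensitivityFamily A b T K R f φ φt g x xt w v) {y : ℝ → E}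
    (hy : LocBddMeas y) {C : ℝ} (hC : ∀ t ∈ Icc (-b) T, ‖y t‖ ≤ C) {σ τ t : ℝ}
    (hσ : σ ∈ Icc 0 b) (hτ : τ ∈ Icc 0 b) (ht : t ∈ Icc 0 T) :
    ‖A (((∫ s in 0..t - σ, y s) - ∫ s in 0..t - τ, y s) -
        ((∫ s in 0..-σ, y s) - ∫ s in 0..-τ, y s))‖ ≤ ‖A‖ * (C * |σ - τ| + C * |σ - τ|) := by
  refine (A.le_opNorm _).trans (mul_le_mul_of_nonneg_left ?_ (norm_nonneg _))
  refine (norm_sub_le _ _).trans (add_le_add ?_ ?_)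
  · have := norm_primitive_sub_le hy hC (h.sub_mem hσ ht) (h.sub_mem hτ ht)
    rwa [sub_sub_sub_cancel_left, abs_sub_comm τ σ] at this
  · have := norm_primitive_sub_le hy hC (h.neg_mem hσ) (h.neg_mem hτ)
    rwa [neg_sub_neg, abs_sub_comm τ σ] at this

lemma shift_primitive_meas {y : ℝ → E} (hy : LocBddMeas y) (σ τ : ℝ) :
    LocBddMeas fun t => A (((∫ s in 0..t - σ, y s) - ∫ s in 0..t - τ, y s) -
        ((∫ s in 0..-σ, y s) - ∫ s in 0..-τ, y s)) := by
  have := hy.continuous_integral 0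
  exact .clm A ((((LocBddMeas.of_continuous this).comp_sub_right σ).sub
    ((LocBddMeas.of_continuous this).comp_sub_right τ)).sub (.const _))

variable [CompleteSpace E]

lemma exists_x_delay_lipschitz (h : SensitivityFamily A b T K R f φ φt g x xt w v) :
    ∃ C, 0 ≤ C ∧ ∀ σ ∈ Icc 0 b, ∀ τ ∈ Icc 0 b, ∀ t ≤ T,
      ‖x σ t - x τ t‖ ≤ C * |σ - τ| := by
  have hK := h.K_nonneg
  have hR := h.R_nonneg
  have hT := h.T_nonneg
  refine ⟨(1 + (K + ‖A‖) * Real.exp ((K + ‖A‖) * T) * T) * (‖A‖ * (R + R)), by positivity,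
    fun σ hσ τ hτ t ht => ?_⟩
  have := delay_bound (c₁ := ‖A‖ * (R * |σ - τ| + R * |σ - τ|)) (c₂ := 0) (K := K) (T := T)
    (k := fun s => (f (x σ s) - g s) - (f (x τ s) - g s)) ((h.x_meas hσ).sub (h.x_meas hτ))
    (fun t ht => by rw [h.x_hist σ hσ t ht, h.x_hist τ hτ t ht, sub_self]) hσ.1
    ((LocBddMeas.const (φ 0 - φ 0)).add (shift_primitive_meas (h.x_meas hτ) σ τ)) hK hT
    (by positivity) le_rfl (fun t ht => ?_) (fun s _ => ?_)
    (fun t ht => delay_sub_eq A (q₁ := fun _ => φ 0) (q₂ := fun _ => φ 0) (h.x_meas hσ)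
      (h.x_meas hτ) (h.force_x_meas hσ) (h.force_x_meas hτ) (h.x_eq σ hσ t ht) (h.x_eq τ hτ t ht))
    t ht
  · refine this.trans (le_of_eq ?_)
    ring
  · rw [sub_self, zero_add]
    exact h.norm_shift_primitive_le (h.x_meas hτ) (h.x_le τ hτ) hσ hτ ⟨ht.1.le, ht.2⟩
  · rw [sub_sub_sub_cancel_right, add_zero]
    exact h.f_lipschitz _ _

lemma exists_x_shift_lipschitz (h : SensitivityFamily A b T K R f φ φt g x xt w v) :
    ∃ C, 0 ≤ C ∧ ∀ σ ∈ Icc 0 b, ∀ τ ∈ Icc 0 b, ∀ t ∈ Icc 0 T,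
      ‖x σ (t - σ) - x τ (t - τ)‖ ≤ C * |σ - τ| := by
  obtain ⟨C, hC, h₁⟩ := h.exists_x_delay_lipschitz
  obtain ⟨D, hD, h₂⟩ := h.exists_x_time_lipschitz
  refine ⟨C + D, by positivity, fun σ hσ τ hτ t ht => ?_⟩
  have e₁ := h₁ σ hσ τ hτ (t - σ) (h.sub_mem hσ ht).2
  have e₂ := h₂ τ hτ (t - σ) (h.sub_mem hσ ht) (t - τ) (h.sub_mem hτ ht)
  rw [sub_sub_sub_cancel_left, abs_sub_comm τ σ] at e₂
  calc _ ≤ ‖x σ (t - σ) - x τ (t - σ)‖ + ‖x τ (t - σ) - x τ (t - τ)‖ :=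
        norm_sub_le_norm_sub_add_norm_sub _ _ _
    _ ≤ _ := by rw [add_mul]; exact add_le_add e₁ e₂

lemma exists_xt_delay_lipschitz (h : SensitivityFamily A b T K R f φ φt g x xt w v) :
    ∃ C, 0 ≤ C ∧ ∀ σ ∈ Icc 0 b, ∀ τ ∈ Icc 0 b, ∀ t ≤ T,
      ‖xt σ t - xt τ t‖ ≤ C * |σ - τ| := by
  obtain ⟨C, hC, h₁⟩ := h.exists_x_delay_lipschitz
  obtain ⟨D, hD, h₂⟩ := h.exists_x_shift_lipschitz
  have hK := h.K_nonneg
  refine ⟨‖A‖ * D + K * C, by positivity, fun σ hσ τ hτ t ht => ?_⟩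
  rw [h.xt_eq, h.xt_eq]
  split_ifs with ht0
  · rw [sub_self, norm_zero]
    positivity
  · rw [not_lt] at ht0
    have e : A (x σ (t - σ)) - (f (x σ t) - g t) - (A (x τ (t - τ)) - (f (x τ t) - g t)) =
        A (x σ (t - σ) - x τ (t - τ)) - (f (x σ t) - f (x τ t)) := by
      rw [map_sub]; abel
    rw [e, add_mul, mul_assoc, mul_assoc]
    refine (norm_sub_le _ _).trans (add_le_add ((A.le_opNorm _).trans ?_)
      ((h.f_lipschitz _ _).trans ?_))
    · have := h₂ σ hσ τ hτ t ⟨ht0, ht⟩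
      gcongr
    · have := h₁ σ hσ τ hτ t ht
      gcongr

lemma exists_w_delay_lipschitz (h : SensitivityFamily A b T K R f φ φt g x xt w v) :
    ∃ C, 0 ≤ C ∧ ∀ σ ∈ Icc 0 b, ∀ τ ∈ Icc 0 b, ∀ t ≤ T,
      ‖w σ t - w τ t‖ ≤ C * |σ - τ| := by
  obtain ⟨C₁, hC₁, h₁⟩ := h.exists_x_delay_lipschitz
  obtain ⟨C₂, hC₂, h₂⟩ := h.exists_x_shift_lipschitz
  obtain ⟨C₃, hC₃, h₃⟩ := h.exists_w_le
  have hK := h.K_nonneg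
  have hT := h.T_nonneg
  refine ⟨(1 + (K + ‖A‖) * Real.exp ((K + ‖A‖) * T) * T) * (‖A‖ * (C₂ + C₂) +
    ‖A‖ * (C₃ + C₃) + T * (K * C₁ * C₃)), by positivity, fun σ hσ τ hτ t ht => ?_⟩
  have hxm : ∀ ρ ∈ Icc 0 b, LocBddMeas fun t => -A (x ρ (t - ρ) - φ (-ρ)) := fun ρ hρ => by
    have := h.x_cont ρ hρ
    exact .of_continuous (by fun_prop)
  have := delay_bound (c₁ := ‖A‖ * (C₂ * |σ - τ| + C₂ * |σ - τ|) +
      ‖A‖ * (C₃ * |σ - τ| + C₃ * |σ - τ|)) (c₂ := K * (C₁ * |σ - τ|) * C₃) (K := K) (T := T)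
    (k := fun s => fderiv ℝ f (x σ s) (w σ s) - fderiv ℝ f (x τ s) (w τ s))
    ((h.w_meas hσ).sub (h.w_meas hτ))
    (fun t ht => by rw [h.w_hist σ hσ t ht, h.w_hist τ hτ t ht, sub_self]) hσ.1
    (((hxm σ hσ).sub (hxm τ hτ)).add (shift_primitive_meas (h.w_meas hτ) σ τ)) hK hT
    (by positivity) (by positivity) (fun t ht => ?_) (fun s hs => ?_)
    (fun t ht => delay_sub_eq A (q₁ := fun t => -A (x σ (t - σ) - φ (-σ)))
      (q₂ := fun t => -A (x τ (t - τ) - φ (-τ))) (h.w_meas hσ)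
      (h.w_meas hτ) (h.force_w_meas hσ) (h.force_w_meas hτ) (h.w_eq σ hσ t ht) (h.w_eq τ hτ t ht))
    t ht
  · refine this.trans (le_of_eq ?_)
    ring
  · have ht' : t ∈ Icc 0 T := ⟨ht.1.le, ht.2⟩
    refine (norm_add_le _ _).trans (add_le_add ?_ (h.norm_shift_primitive_le (h.w_meas hτ)
      (fun t ht => h₃ τ hτ t ht.2) hσ hτ ht'))
    have e : -A (x σ (t - σ) - φ (-σ)) - -A (x τ (t - τ) - φ (-τ)) =
        A ((x σ (0 - σ) - x τ (0 - τ)) - (x σ (t - σ) - x τ (t - τ))) := by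
      rw [h.x_hist σ hσ (0 - σ) (by linarith [hσ.1]), h.x_hist τ hτ (0 - τ) (by linarith [hτ.1])]
      simp only [map_sub, zero_sub]
      abel
    rw [e]
    exact (A.le_opNorm _).trans (mul_le_mul_of_nonneg_left ((norm_sub_le _ _).trans (add_le_add
      (h₂ σ hσ τ hτ 0 ⟨le_rfl, hT⟩) (h₂ σ hσ τ hτ t ht'))) (norm_nonneg _))
  · have e : fderiv ℝ f (x σ s) (w σ s) - fderiv ℝ f (x τ s) (w τ s) =
        fderiv ℝ f (x σ s) (w σ s - w τ s) +
          (fderiv ℝ f (x σ s) - fderiv ℝ f (x τ s)) (w τ s) := by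
      simp only [map_sub, sub_apply]
      abel
    rw [e]
    refine (norm_add_le _ _).trans (add_le_add (h.norm_lin_le _ _)
      ((ContinuousLinearMap.le_opNorm _ _).trans ?_))
    have e₁ := (h.fderiv_lipschitz (x σ s) (x τ s)).trans
      (mul_le_mul_of_nonneg_left (h₁ σ hσ τ hτ s hs.2) hK)
    exact mul_le_mul e₁ (h₃ τ hτ s hs.2) (norm_nonneg _) (by positivity)

/-! ### The derivatives with respect to the delay -/

theorem hasDerivWithinAt_x (h : SensitivityFamily A b T K R f φ φt g x xt w v) {τ : ℝ}
    (hτ : τ ∈ Icc 0 b) : ∀ t ≤ T, HasDerivWithinAt (fun σ => x σ t) (w τ t) (Icc 0 b) τ := by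
  intro t ht
  rcases le_or_gt t 0 with ht0 | ht0
  · rw [h.w_hist τ hτ t ht0]
    exact (hasDerivWithinAt_const τ (Icc 0 b) (φ t)).congr (fun σ hσ => h.x_hist σ hσ t ht0)
      (h.x_hist τ hτ t ht0)
  obtain ⟨C, hC, h₁⟩ := h.exists_x_delay_lipschitz
  have hK := h.K_nonneg
  refine delay_hasDerivWithinAt (A := A) (q := fun _ _ => φ 0) (dq := fun _ => 0)
    (n := fun σ s => f (x σ s) - g s) (dn := fun s => fderiv ℝ f (x τ s) (w τ s))
    (κ := fun σ s => ‖slope (fun σ => f (x σ s)) τ σ -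
      fderiv ℝ f (x τ s) (slope (fun σ => x σ s) τ σ)‖)
    (C := K * C + K * C) (Z := ∅) h.T_nonneg hK hτ countable_empty (fun σ hσ => h.x_meas hσ)
    (h.x_cont τ hτ) (fun σ hσ t ht => by rw [h.x_hist σ hσ t ht, h.x_hist τ hτ t ht])
    (fun _ _ => .const _) (fun σ hσ => h.force_x_meas hσ) h.x_eq (h.w_meas hτ) (h.w_hist τ hτ)
    (.const _) (h.force_w_meas hτ) (fun t ht => ?_) (fun σ hσ hne => ⟨?_, fun _ => norm_nonneg _,
      fun s hs => ?_, fun s hs => ?_⟩) (fun σ _ t _ => ?_) (fun t htI _ => ?_)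
    (fun t _ _ => hasDerivWithinAt_const _ _ _) t ⟨ht0, ht⟩ (notMem_empty t)
  · rw [h.w_eq τ hτ t ht, h.x_hist τ hτ (-τ) (by linarith [hτ.1]), zero_sub]
  · simp only [slope_def_module]
    have := h.f_contDiff.continuous
    have := h.x_cont σ hσ
    have := h.x_cont τ hτ
    have := h.contDiff_fderiv.continuous
    exact .of_continuous (by fun_prop)
  · have e := h₁ σ hσ τ hτ s hs.2
    refine (norm_sub_le _ _).trans (add_le_add (norm_slope_le hne ((h.f_lipschitz _ _).trans ?_))
      ((h.norm_lin_le _ _).trans (mul_le_mul_of_nonneg_left (norm_slope_le hne e) hK)))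
    rw [mul_assoc]
    gcongr
  · have e : slope (fun σ => f (x σ s) - g s) τ σ - fderiv ℝ f (x τ s) (w τ s) =
        fderiv ℝ f (x τ s) (slope (fun σ => x σ s) τ σ - w τ s) +
          (slope (fun σ => f (x σ s)) τ σ -
            fderiv ℝ f (x τ s) (slope (fun σ => x σ s) τ σ)) := by
      rw [map_sub]
      simp only [slope_def_module, sub_sub_sub_cancel_right]
      abel
    rw [e]
    exact (norm_add_le _ _).trans (add_le_add (h.norm_lin_le _ _) le_rfl)
  · rw [sub_self, norm_zero]
    positivity
  · -- The remainder is that of the first-order expansion of `f`, evaluated at an increment of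
    -- order `σ - τ`.
    have hx : Tendsto (fun σ => x σ t) (𝓝[Icc 0 b \ {τ}] τ) (𝓝 (x τ t)) := by
      rw [tendsto_iff_norm_sub_tendsto_zero]
      refine squeeze_zero' (Eventually.of_forall fun _ => norm_nonneg _)
        (eventually_mem_nhdsWithin.mono fun σ hσ => h₁ σ hσ.1 τ hτ t htI.2) ?_
      have : Continuous fun σ : ℝ => C * |σ - τ| := by fun_prop
      simpa using (this.tendsto τ).mono_left nhdsWithin_le_nhds
    have ho := ((h.f_differentiable (x τ t)).hasFDerivAt.isLittleO).comp_tendsto hx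
    have hO : (fun σ => x σ t - x τ t) =O[𝓝[Icc 0 b \ {τ}] τ] fun σ => σ - τ :=
      Asymptotics.IsBigO.of_bound C (eventually_mem_nhdsWithin.mono fun σ hσ =>
        h₁ σ hσ.1 τ hτ t htI.2)
    have h2 := (ho.trans_isBigO hO).tendsto_inv_smul_nhds_zero
    refine tendsto_zero_iff_norm_tendsto_zero.mp (h2.congr fun σ => ?_)
    simp only [Function.comp_apply, slope_def_module, map_smul, map_sub, smul_sub]

end SensitivityFamily

namespace SensitivityFamily

variable {E : Type*} [NormedAddCommGroup E] [NormedSpace ℝ E]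
variable {A : E →L[ℝ] E} {b T K R : ℝ} {f : E → E} {φ φt g : ℝ → E} {x xt w v : ℝ → ℝ → E}

lemma continuousAt_xt (h : SensitivityFamily A b T K R f φ φt g x xt w v) {τ t : ℝ}
    (hτ : τ ∈ Icc 0 b) (ht : t ≠ 0) : ContinuousAt (xt τ) t := by
  rcases lt_or_gt_of_ne ht with h0 | h0
  · refine h.φt_cont.continuousAt.congr ?_
    filter_upwards [Iio_mem_nhds h0] with s hs
    rw [h.xt_eq, if_pos (mem_Iio.mp hs)]
  · refine (h.xt_pos_cont hτ).continuousAt.congr ?_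
    filter_upwards [Ioi_mem_nhds h0] with s hs
    rw [h.xt_eq, if_neg (not_lt.mpr (mem_Ioi.mp hs).le)]

variable [CompleteSpace E]

lemma hasDerivWithinAt_x_time (h : SensitivityFamily A b T K R f φ φt g x xt w v) {τ t : ℝ}
    (hτ : τ ∈ Icc 0 b) (ht : t ∈ Icc (-b) T) (ht0 : t ≠ 0) :
    HasDerivWithinAt (x τ) (xt τ t) (Icc (-b) T) t := by
  have h1 := (intervalIntegral.integral_hasDerivAt_right ((h.xt_meas hτ).intervalIntegrable 0 t)
    (h.xt_meas hτ).meas.stronglyMeasurableAtFilter (h.continuousAt_xt hτ ht0)).const_add (φ 0)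
  exact h1.hasDerivWithinAt.congr (fun s hs => h.x_eq_primitive hτ hs) (h.x_eq_primitive hτ ht)

lemma hasDerivWithinAt_φ (h : SensitivityFamily A b T K R f φ φt g x xt w v) {t : ℝ}
    (ht : t ∈ Icc (-b) 0) : HasDerivWithinAt φ (φt t) (Icc (-b) 0) t := by
  have h1 := (intervalIntegral.integral_hasDerivAt_right (h.φt_cont.intervalIntegrable 0 t)
    h.φt_cont.stronglyMeasurable.stronglyMeasurableAtFilter h.φt_cont.continuousAt).const_add (φ 0)
  exact h1.hasDerivWithinAt.congr (fun s hs => h.φ_eq s hs) (h.φ_eq t ht)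

lemma tendsto_of_delay_lipschitz {F : Type*} [NormedAddCommGroup F] {u : ℝ → F} {c τ : ℝ}
    {S : Set ℝ} (hu : ∀ σ ∈ S, ‖u σ - u τ‖ ≤ c * |σ - τ|) : Tendsto u (𝓝[S] τ) (𝓝 (u τ)) := by
  rw [tendsto_iff_norm_sub_tendsto_zero]
  refine squeeze_zero' (Eventually.of_forall fun _ => norm_nonneg _)
    (eventually_mem_nhdsWithin.mono fun σ hσ => hu σ hσ) ?_
  have : Continuous fun σ : ℝ => c * |σ - τ| := by fun_prop
  simpa using (this.tendsto τ).mono_left nhdsWithin_le_nhds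

/-- The delay enters `x σ (t - σ)` twice. The mixed increment is of second order, because
`x σ - x τ` is Lipschitz continuous in time with a constant of order `σ - τ`. -/
lemma hasDerivWithinAt_x_shift (h : SensitivityFamily A b T K R f φ φt g x xt w v) {τ t : ℝ}
    (hτ : τ ∈ Icc 0 b) (ht : t ∈ Icc 0 T) (htτ : t ≠ τ) :
    HasDerivWithinAt (fun σ => x σ (t - σ)) (w τ (t - τ) - xt τ (t - τ)) (Icc 0 b) τ := by
  obtain ⟨C, hC, h₁⟩ := h.exists_xt_delay_lipschitz
  have hmix : HasDerivWithinAt (fun σ => (x σ (t - σ) - x σ (t - τ)) - (x τ (t - σ) - x τ (t - τ)))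
      0 (Icc 0 b) τ := by
    rw [hasDerivWithinAt_iff_isLittleO]
    have hO : (fun σ => (x σ (t - σ) - x σ (t - τ)) - (x τ (t - σ) - x τ (t - τ)))
        =O[𝓝[Icc 0 b] τ] fun σ => |σ - τ| * (σ - τ) := by
      refine Asymptotics.IsBigO.of_bound C (eventually_mem_nhdsWithin.mono fun σ hσ => ?_)
      rw [h.x_sub_eq hσ (h.sub_mem hσ ht) (h.sub_mem hτ ht),
        h.x_sub_eq hτ (h.sub_mem hσ ht) (h.sub_mem hτ ht), sub_sub_sub_comm,
        ← intervalIntegral.integral_sub ((h.xt_meas hσ).intervalIntegrable _ _)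
          ((h.xt_meas hτ).intervalIntegrable _ _),
        ← intervalIntegral.integral_sub ((h.xt_meas hσ).intervalIntegrable _ _)
          ((h.xt_meas hτ).intervalIntegrable _ _)]
      have := norm_primitive_sub_le ((h.xt_meas hσ).sub (h.xt_meas hτ))
        (fun r hr => h₁ σ hσ τ hτ r hr.2) (h.sub_mem hσ ht) (h.sub_mem hτ ht)
      rw [sub_sub_sub_cancel_left, abs_sub_comm τ σ] at this
      rw [norm_mul, Real.norm_eq_abs, Real.norm_eq_abs, abs_abs, ← mul_assoc]
      exact this
    have ho : (fun σ => |σ - τ| * (σ - τ)) =o[𝓝[Icc 0 b] τ] fun σ => σ - τ := by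
      have h0 : Tendsto (fun σ => |σ - τ|) (𝓝[Icc 0 b] τ) (𝓝 0) := by
        have : Continuous fun σ : ℝ => |σ - τ| := by fun_prop
        simpa using (this.tendsto τ).mono_left nhdsWithin_le_nhds
      simpa using ((Asymptotics.isLittleO_one_iff ℝ).mpr h0).mul_isBigO
        (Asymptotics.isBigO_refl (fun σ => σ - τ) (𝓝[Icc 0 b] τ))
    simpa using hO.trans_isLittleO ho
  have htime : HasDerivWithinAt (fun σ => x τ (t - σ)) (-xt τ (t - τ)) (Icc 0 b) τ := by
    have e := (h.hasDerivWithinAt_x_time hτ (h.sub_mem hτ ht) (sub_ne_zero.mpr htτ)).scomp τ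
      ((hasDerivAt_id τ).const_sub t).hasDerivWithinAt (s := Icc 0 b)
      (fun σ hσ => h.sub_mem hσ ht)
    simpa [Function.comp_def] using e
  have hdel := h.hasDerivWithinAt_x hτ (t - τ) (h.sub_mem hτ ht).2
  have := (hmix.add hdel).add (htime.sub_const (x τ (t - τ)))
  refine (this.congr_deriv (by abel)).congr_of_mem (fun σ _ => ?_) hτ
  simp only [Pi.add_apply]
  abel

lemma hasDerivWithinAt_φ_neg (h : SensitivityFamily A b T K R f φ φt g x xt w v) {τ : ℝ}
    (hτ : τ ∈ Icc 0 b) : HasDerivWithinAt (fun σ => φ (-σ)) (-φt (-τ)) (Icc 0 b) τ := by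
  have e := (h.hasDerivWithinAt_φ (t := -τ) ⟨by linarith [hτ.2], by linarith [hτ.1]⟩).scomp τ
    (hasDerivAt_neg τ).hasDerivWithinAt (s := Icc 0 b)
    (fun σ hσ => ⟨by linarith [hσ.2], by linarith [hσ.1]⟩)
  simpa [Function.comp_def] using e

lemma tendsto_clm_apply {ι F G : Type*} [NormedAddCommGroup F] [NormedSpace ℝ F]
    [NormedAddCommGroup G] [NormedSpace ℝ G] {l : Filter ι} {L : ι → F →L[ℝ] G} {L₀ : F →L[ℝ] G}
    {u : ι → F} {u₀ : F} (hL : Tendsto L l (𝓝 L₀)) (hu : Tendsto u l (𝓝 u₀)) :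
    Tendsto (fun i => L i (u i)) l (𝓝 (L₀ u₀)) :=
  ((isBoundedBilinearMap_apply (𝕜 := ℝ) (E := F) (F := G)).continuous.tendsto (L₀, u₀)).comp
    (hL.prodMk_nhds hu)

theorem hasDerivWithinAt_w (h : SensitivityFamily A b T K R f φ φt g x xt w v) {τ : ℝ}
    (hτ : τ ∈ Icc 0 b) : ∀ t ≤ T, t ≠ τ →
      HasDerivWithinAt (fun σ => w σ t) (v τ t) (Icc 0 b) τ := by
  intro t ht htτ
  rcases le_or_gt t 0 with ht0 | ht0
  · rw [h.v_hist τ hτ t ht0]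
    exact (hasDerivWithinAt_const τ (Icc 0 b) (0 : E)).congr (fun σ hσ => h.w_hist σ hσ t ht0)
      (h.w_hist τ hτ t ht0)
  obtain ⟨C₁, hC₁, h₁⟩ := h.exists_x_delay_lipschitz
  obtain ⟨C₂, hC₂, h₂⟩ := h.exists_w_le
  obtain ⟨C₃, hC₃, h₃⟩ := h.exists_x_shift_lipschitz
  obtain ⟨C₄, hC₄, h₄⟩ := h.exists_w_delay_lipschitz
  have hK := h.K_nonneg
  have hwm : ∀ σ ∈ Icc 0 b, LocBddMeas fun t => -A (x σ (t - σ) - φ (-σ)) := fun σ hσ => by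
    have := h.x_cont σ hσ
    exact .of_continuous (by fun_prop)
  refine delay_hasDerivWithinAt (A := A) (q := fun σ t => -A (x σ (t - σ) - φ (-σ)))
    (dq := fun t => -A ((w τ (t - τ) - xt τ (t - τ)) + φt (-τ)))
    (n := fun σ s => fderiv ℝ f (x σ s) (w σ s))
    (dn := fun s => fderiv ℝ f (x τ s) (v τ s) +
        fderiv ℝ (fderiv ℝ f) (x τ s) (w τ s) (w τ s))
    (κ := fun σ s => ‖slope (fun σ => fderiv ℝ f (x σ s)) τ σ (w σ s) -
      fderiv ℝ (fderiv ℝ f) (x τ s) (w τ s) (w τ s)‖)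
    (C := max (K * C₁ * C₂ + K * C₂ * C₂) (‖A‖ * (C₃ + C₃))) (Z := {τ}) h.T_nonneg hK hτ
    (countable_singleton τ) (fun σ hσ => h.w_meas hσ)
    (h.w_cont τ hτ) (fun σ hσ t ht => by rw [h.w_hist σ hσ t ht, h.w_hist τ hτ t ht])
    hwm (fun σ hσ => h.force_w_meas hσ) h.w_eq (h.v_meas τ hτ) (h.v_hist τ hτ)
    ?_ (h.force_v_meas hτ) (fun t ht => ?_) (fun σ hσ hne => ⟨?_, fun _ => norm_nonneg _,
      fun s hs => ?_, fun s hs => ?_⟩) (fun σ hσ t ht => ?_) (fun t htI htZ => ?_)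
    (fun t htI htZ => ?_) t ⟨ht0, ht⟩ htτ
  · have := (LocBddMeas.clm (-A) ((((h.w_meas hτ).comp_sub_right τ).sub
      ((h.xt_meas hτ).comp_sub_right τ)).add (.const (φt (-τ)))))
    exact this
  · rw [h.v_eq τ hτ t ht, h.w_hist τ hτ (-τ) (by linarith [hτ.1])]
    simp only [map_sub, map_add, map_zero]
    module
  · simp only [slope_def_module]
    have e := ((h.fderiv_x_meas hσ).sub (h.fderiv_x_meas hτ)).const_smul (σ - τ)⁻¹
    exact ((e.clm_apply (h.w_meas hσ)).sub (h.quad_meas hτ)).norm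
  · refine le_trans ?_ (le_max_left _ _)
    have e := h₁ σ hσ τ hτ s hs.2
    have e₁ := h₂ σ hσ s hs.2
    have e₂ := h₂ τ hτ s hs.2
    have e₃ : ‖slope (fun σ => fderiv ℝ f (x σ s)) τ σ‖ ≤ K * C₁ := by
      refine norm_slope_le hne ((h.fderiv_lipschitz _ _).trans ?_)
      rw [mul_assoc]
      gcongr
    refine (norm_sub_le _ _).trans (add_le_add ((ContinuousLinearMap.le_opNorm _ _).trans ?_)
      ((h.norm_quad_le _ _ _).trans ?_))
    · gcongr
    · gcongr
  · have e : slope (fun σ => fderiv ℝ f (x σ s) (w σ s)) τ σ - (fderiv ℝ f (x τ s) (v τ s) +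
        fderiv ℝ (fderiv ℝ f) (x τ s) (w τ s) (w τ s)) =
        fderiv ℝ f (x τ s) (slope (fun σ => w σ s) τ σ - v τ s) +
          (slope (fun σ => fderiv ℝ f (x σ s)) τ σ (w σ s) -
            fderiv ℝ (fderiv ℝ f) (x τ s) (w τ s) (w τ s)) := by
      simp only [slope_def_module, map_sub, map_smul, smul_apply, sub_apply, smul_sub]
      abel
    rw [e]
    exact (norm_add_le _ _).trans (add_le_add (h.norm_lin_le _ _) le_rfl)
  · have ht' : t ∈ Icc 0 T := ⟨ht.1.le, ht.2⟩
    have e : -A (x σ (t - σ) - φ (-σ)) - -A (x τ (t - τ) - φ (-τ)) =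
        A ((x σ (0 - σ) - x τ (0 - τ)) - (x σ (t - σ) - x τ (t - τ))) := by
      rw [h.x_hist σ hσ (0 - σ) (by linarith [hσ.1]), h.x_hist τ hτ (0 - τ) (by linarith [hτ.1])]
      simp only [map_sub, zero_sub]
      abel
    rw [e]
    refine ((A.le_opNorm _).trans (mul_le_mul_of_nonneg_left ((norm_sub_le _ _).trans (add_le_add
      (h₃ σ hσ τ hτ 0 ⟨le_rfl, h.T_nonneg⟩) (h₃ σ hσ τ hτ t ht'))) (norm_nonneg _))).trans ?_
    rw [← add_mul, ← mul_assoc]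
    gcongr
    exact le_max_right _ _
  · have hD := (h.fderiv_differentiable (x τ t)).hasFDerivAt.comp_hasDerivWithinAt τ
      (h.hasDerivWithinAt_x hτ t htI.2)
    have e₁ := hasDerivWithinAt_iff_tendsto_slope.mp hD
    have e₂ : Tendsto (fun σ => w σ t) (𝓝[Icc 0 b \ {τ}] τ) (𝓝 (w τ t)) :=
      tendsto_of_delay_lipschitz fun σ hσ => h₄ σ hσ.1 τ hτ t htI.2
    have e₃ := ((tendsto_clm_apply e₁ e₂).sub_const
      (fderiv ℝ (fderiv ℝ f) (x τ t) (w τ t) (w τ t))).norm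
    simpa [Function.comp_def] using e₃
  · have e := ((h.hasDerivWithinAt_x_shift hτ ⟨htI.1.le, htI.2⟩ htZ).sub
      (h.hasDerivWithinAt_φ_neg hτ))
    have e₁ := ((-A).hasFDerivAt.comp_hasDerivWithinAt τ e)
    refine (e₁.congr_deriv ?_)
    rw [sub_neg_eq_add, neg_apply]

theorem tendsto_v (h : SensitivityFamily A b T K R f φ φt g x xt w v) {τ : ℝ}
    (hτ : τ ∈ Icc 0 b) : ∀ t ≤ T, t ≠ τ →
      Tendsto (fun σ => v σ t) (𝓝[Icc 0 b] τ) (𝓝 (v τ t)) := by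
  intro t ht htτ
  rcases le_or_gt t 0 with ht0 | ht0
  · refine tendsto_const_nhds.congr' (eventually_mem_nhdsWithin.mono fun σ hσ => ?_)
    simp only [h.v_hist τ hτ t ht0, h.v_hist σ hσ t ht0]
  obtain ⟨C₁, hC₁, h₁⟩ := h.exists_x_delay_lipschitz
  obtain ⟨C₂, hC₂, h₂⟩ := h.exists_w_le
  obtain ⟨C₃, hC₃, h₃⟩ := h.exists_w_delay_lipschitz
  obtain ⟨C₄, hC₄, h₄⟩ := h.exists_v_le
  obtain ⟨C₅, hC₅, h₅⟩ := h.exists_impulse_le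
  obtain ⟨C₆, hC₆, h₆⟩ := h.exists_xt_delay_lipschitz
  have hK := h.K_nonneg
  have hT := h.T_nonneg
  set V : ℝ → E := fun r => ∫ s in 0..r, v τ s with hV
  have hVc : Continuous V := (h.v_meas τ hτ).continuous_integral 0
  have hxl : ∀ t ≤ T, Tendsto (fun σ => x σ t) (𝓝[Icc 0 b] τ) (𝓝 (x τ t)) := fun t ht =>
    tendsto_of_delay_lipschitz fun σ hσ => h₁ σ hσ τ hτ t ht
  have hwl : ∀ t ≤ T, Tendsto (fun σ => w σ t) (𝓝[Icc 0 b] τ) (𝓝 (w τ t)) := fun t ht =>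
    tendsto_of_delay_lipschitz fun σ hσ => h₃ σ hσ τ hτ t ht
  have hl : 𝓝[Icc 0 b] τ ≤ 𝓝 τ := nhdsWithin_le_nhds
  -- Convergence along the shifted times `t - σ`, from convergence that is uniform in time.
  have hshift : ∀ {u : ℝ → ℝ → E} {C : ℝ}, (∀ σ ∈ Icc 0 b, ∀ t ≤ T, ‖u σ t - u τ t‖ ≤ C * |σ - τ|) →
      ∀ t ∈ Ioc 0 T, ContinuousAt (u τ) (t - τ) →
        Tendsto (fun σ => u σ (t - σ)) (𝓝[Icc 0 b] τ) (𝓝 (u τ (t - τ))) := by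
    intro u C hu t ht hc
    have e₁ : Tendsto (fun σ => u σ (t - σ) - u τ (t - σ)) (𝓝[Icc 0 b] τ) (𝓝 0) := by
      have := tendsto_of_delay_lipschitz (u := fun σ => u σ (t - σ) - u τ (t - σ)) (c := C) (τ := τ)
        (S := Icc 0 b) fun σ hσ => by
          rw [sub_self, sub_zero]
          exact hu σ hσ _ (by linarith [hσ.1, ht.2])
      simpa using this
    have e₂ : Tendsto (fun σ => u τ (t - σ)) (𝓝[Icc 0 b] τ) (𝓝 (u τ (t - τ))) := by
      have : ContinuousAt (fun σ : ℝ => t - σ) τ := by fun_prop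
      exact (ContinuousAt.comp (f := fun σ : ℝ => t - σ) hc this).tendsto.mono_left hl
    simpa using e₁.add e₂
  have key := delay_tendsto_zero (A := A) (l := 𝓝[Icc 0 b] τ) (z := fun σ t => v σ t - v τ t)
    (a := fun σ t => ((A (xt σ (t - σ) - φt (-σ)) - (2 : ℝ) • A (w σ (t - σ))) -
      (A (xt τ (t - τ) - φt (-τ)) - (2 : ℝ) • A (w τ (t - τ)))) +
      A (((∫ s in 0..t - σ, v τ s) - ∫ s in 0..t - τ, v τ s) -
        ((∫ s in 0..-σ, v τ s) - ∫ s in 0..-τ, v τ s)))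
    (k := fun σ s => (fderiv ℝ f (x σ s) (v σ s) +
        fderiv ℝ (fderiv ℝ f) (x σ s) (w σ s) (w σ s)) - (fderiv ℝ f (x τ s) (v τ s) +
        fderiv ℝ (fderiv ℝ f) (x τ s) (w τ s) (w τ s)))
    (κ := fun σ s => ‖(fderiv ℝ f (x σ s) (v τ s) - fderiv ℝ f (x τ s) (v τ s)) +
      (fderiv ℝ (fderiv ℝ f) (x σ s) (w σ s) (w σ s) -
        fderiv ℝ (fderiv ℝ f) (x τ s) (w τ s) (w τ s))‖)
    (K := K) (T := T) (C := max (C₅ + C₅ + ‖A‖ * (C₄ * b + C₄ * b))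
      (K * C₄ + K * C₄ + (K * C₂ * C₂ + K * C₂ * C₂))) (Z := {τ}) (countable_singleton τ) hK
      ?_ ?_ ?_ t ⟨ht0, ht⟩ htτ
  · simpa using key.add_const (v τ t)
  · filter_upwards [self_mem_nhdsWithin] with σ hσ
    refine ⟨hσ.1, (h.v_meas σ hσ).sub (h.v_meas τ hτ), fun t ht => ?_,
      ((h.impulse_meas hσ).sub (h.impulse_meas hτ)).add (shift_primitive_meas (h.v_meas τ hτ) σ τ),
      ((((h.fderiv_x_meas hσ).clm_apply (h.v_meas τ hτ)).sub
        ((h.fderiv_x_meas hτ).clm_apply (h.v_meas τ hτ))).add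
        ((h.quad_meas hσ).sub (h.quad_meas hτ))).norm, fun _ => norm_nonneg _, fun s hs => ?_,
      fun t ht => delay_sub_eq A (q₁ := fun t => A (xt σ (t - σ) - φt (-σ)) -
          (2 : ℝ) • A (w σ (t - σ)))
        (q₂ := fun t => A (xt τ (t - τ) - φt (-τ)) - (2 : ℝ) • A (w τ (t - τ)))
        (h.v_meas σ hσ) (h.v_meas τ hτ) (h.force_v_meas hσ) (h.force_v_meas hτ)
        (h.v_eq σ hσ t ht) (h.v_eq τ hτ t ht), fun t ht => ?_, fun s hs => ?_⟩
    · rw [h.v_hist σ hσ t ht, h.v_hist τ hτ t ht, sub_self]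
    · have e : (fderiv ℝ f (x σ s) (v σ s) +
          fderiv ℝ (fderiv ℝ f) (x σ s) (w σ s) (w σ s)) - (fderiv ℝ f (x τ s) (v τ s) +
          fderiv ℝ (fderiv ℝ f) (x τ s) (w τ s) (w τ s)) =
          fderiv ℝ f (x σ s) (v σ s - v τ s) +
          ((fderiv ℝ f (x σ s) (v τ s) - fderiv ℝ f (x τ s) (v τ s)) +
            (fderiv ℝ (fderiv ℝ f) (x σ s) (w σ s) (w σ s) -
            fderiv ℝ (fderiv ℝ f) (x τ s) (w τ s) (w τ s))) := by
        rw [map_sub]; abel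
      rw [e]
      exact (norm_add_le _ _).trans (add_le_add (h.norm_lin_le _ _) le_rfl)
    · refine le_trans ?_ (le_max_left _ _)
      refine (norm_add_le _ _).trans (add_le_add ((norm_sub_le _ _).trans (add_le_add
        (h₅ σ hσ t ht) (h₅ τ hτ t ht))) ((h.norm_shift_primitive_le (h.v_meas τ hτ)
        (fun t ht => h₄ τ hτ t ht.2) hσ hτ ⟨ht.1.le, ht.2⟩).trans ?_))
      have : |σ - τ| ≤ b := by
        rw [abs_le]
        constructor <;> linarith [hσ.1, hσ.2, hτ.1, hτ.2]
      gcongr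
    · refine le_trans ?_ (le_max_right _ _)
      have e₁ := h₂ σ hσ s hs.2
      have e₂ := h₂ τ hτ s hs.2
      have e₃ := mul_le_mul_of_nonneg_left (h₄ τ hτ s hs.2) hK
      have e₄ : ∀ ρ ∈ Icc 0 b, K * ‖w ρ s‖ * ‖w ρ s‖ ≤ K * C₂ * C₂ := fun ρ hρ => by
        have := h₂ ρ hρ s hs.2
        gcongr
      exact (norm_add_le _ _).trans (add_le_add ((norm_sub_le _ _).trans (add_le_add
        ((h.norm_lin_le _ _).trans e₃) ((h.norm_lin_le _ _).trans e₃)))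
        ((norm_sub_le _ _).trans (add_le_add ((h.norm_quad_le _ _ _).trans (e₄ σ hσ))
          ((h.norm_quad_le _ _ _).trans (e₄ τ hτ)))))
  · intro t ht htZ
    have e₁ := hshift (u := xt) (fun σ hσ t ht => h₆ σ hσ τ hτ t ht) t ht
      (h.continuousAt_xt hτ (sub_ne_zero.mpr htZ))
    have e₂ := hshift (u := w) (fun σ hσ t ht => h₃ σ hσ τ hτ t ht) t ht
      (h.w_cont τ hτ).continuousAt
    have e₃ : Tendsto (fun σ => φt (-σ)) (𝓝[Icc 0 b] τ) (𝓝 (φt (-τ))) :=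
      ((h.φt_cont.comp continuous_neg).tendsto τ).mono_left hl
    have e₄ : ∀ r, Tendsto (fun σ => V (r - σ)) (𝓝[Icc 0 b] τ) (𝓝 (V (r - τ))) := fun r =>
      ((hVc.comp (continuous_const.sub continuous_id)).tendsto τ).mono_left hl
    have hA : ∀ {u : ℝ → E} {p : E}, Tendsto u (𝓝[Icc 0 b] τ) (𝓝 p) →
        Tendsto (fun σ => A (u σ)) (𝓝[Icc 0 b] τ) (𝓝 (A p)) := fun hu =>
      (A.continuous.tendsto _).comp hu
    have e₅ := (((hA (e₁.sub e₃)).sub ((hA e₂).const_smul (2 : ℝ))).sub_const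
      (A (xt τ (t - τ) - φt (-τ)) - (2 : ℝ) • A (w τ (t - τ)))).add
      (hA (((e₄ t).sub_const (V (t - τ))).sub ((e₄ 0).sub_const (V (0 - τ)))))
    simpa only [hV, sub_self, zero_sub, map_zero, add_zero] using e₅
  · intro t ht htZ
    have e₁ := (h.contDiff_fderiv.continuous.tendsto _).comp (hxl t ht.2)
    have e₂ := (h.fderiv_fderiv_cont.tendsto _).comp (hxl t ht.2)
    have e₃ := ((tendsto_clm_apply e₁ (tendsto_const_nhds (x := v τ t))).sub_const
      (fderiv ℝ f (x τ t) (v τ t))).add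
      ((tendsto_clm_apply (tendsto_clm_apply e₂ (hwl t ht.2)) (hwl t ht.2)).sub_const
        (fderiv ℝ (fderiv ℝ f) (x τ t) (w τ t) (w τ t)))
    simpa using e₃.norm

end SensitivityFamily

lemma exists_bounds_of_hasCompactSupport {E : Type*} [NormedAddCommGroup E] [NormedSpace ℝ E]
    {H : E → E} (hH : ContDiff ℝ 2 H) (hs : HasCompactSupport H) :
    ∃ K, (∀ p, ‖H p‖ ≤ K) ∧ (∀ p, ‖fderiv ℝ H p‖ ≤ K) ∧
      ∀ p, ‖fderiv ℝ (fderiv ℝ H) p‖ ≤ K := by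
  have h1 : ContDiff ℝ 1 (fderiv ℝ H) := hH.fderiv_right (by norm_num)
  have hs1 : HasCompactSupport (fderiv ℝ H) := hs.fderiv (𝕜 := ℝ)
  have hs2 : HasCompactSupport (fderiv ℝ (fderiv ℝ H)) := hs1.fderiv (𝕜 := ℝ)
  have h2 : Continuous (fderiv ℝ (fderiv ℝ H)) := h1.continuous_fderiv (by norm_num)
  obtain ⟨K₀, hK₀⟩ := hs.exists_bound_of_continuous hH.continuous
  obtain ⟨K₁, hK₁⟩ := hs1.exists_bound_of_continuous h1.continuous
  obtain ⟨K₂, hK₂⟩ := hs2.exists_bound_of_continuous h2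
  refine ⟨max K₀ (max K₁ K₂), fun p => ?_, fun p => ?_, fun p => ?_⟩
  · exact le_max_of_le_left (hK₀ p)
  · exact le_max_of_le_right (le_max_of_le_left (hK₁ p))
  · exact le_max_of_le_right (le_max_of_le_right (hK₂ p))

section Existence

variable {E : Type*} [NormedAddCommGroup E] [InnerProductSpace ℝ E]

/-! ### The a priori bound and the truncated nonlinearity -/

/-- The one-sided bound on the derivative, integrated along the segment from `0` to `p`. -/
lemma neg_mul_norm_sq_le_inner {f : E → E} (hf : Differentiable ℝ f) {c : ℝ}
    (hmono : ∀ p y : E, 0 ≤ inner ℝ (fderiv ℝ f p y + c • y) y) (p : E) :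
    -c * ‖p‖ ^ 2 ≤ inner ℝ (f p - f 0) p := by
  have hd : ∀ s : ℝ, HasDerivAt (fun s : ℝ => inner ℝ (f (s • p)) p)
      (inner ℝ (fderiv ℝ f (s • p) p) p) s := by
    intro s
    have h1 : HasDerivAt (fun s : ℝ => s • p) p s := by
      simpa using (hasDerivAt_id s).smul_const p
    have h2 := (hf (s • p)).hasFDerivAt.comp_hasDerivAt s h1
    simpa using h2.inner ℝ (hasDerivAt_const s p)
  obtain ⟨s, -, hs⟩ := exists_hasDerivAt_eq_slope (fun s : ℝ => inner ℝ (f (s • p)) p)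
    (fun s => inner ℝ (fderiv ℝ f (s • p) p) p) zero_lt_one
    (fun s _ => (hd s).continuousAt.continuousWithinAt) (fun s _ => hd s)
  have h3 := hmono (s • p) p
  rw [inner_add_left, hs, inner_smul_left, real_inner_self_eq_norm_sq] at h3
  simp only [one_smul, zero_smul, sub_zero, div_one, conj_trivial] at h3
  rw [inner_sub_left]
  linarith

/-- The energy estimate: solutions of the delay equation are bounded, by a constant that depends on
the nonlinearity only through its value at `0` and its one-sided bound, and not on the delay. -/
lemma exists_delay_a_priori_bound [CompleteSpace E] (A : E →L[ℝ] E) {b T c : ℝ} (hb : 0 ≤ b)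
    (hT : 0 ≤ T) (hc : 0 ≤ c) (f₀ : E) {φ g : ℝ → E} (hφ : Continuous φ) (hg : Continuous g) :
    ∃ R, ∀ τ ∈ Icc 0 b, ∀ F : E → E, Continuous F → F 0 = f₀ →
      (∀ p, -c * ‖p‖ ^ 2 ≤ inner ℝ (F p - F 0) p) → ∀ y : ℝ → E, Continuous y →
      (∀ t ≤ 0, y t = φ t) →
      (∀ t ∈ Ioc 0 T, y t = φ 0 + ∫ s in 0..t, (A (y (s - τ)) - (F (y s) - g s))) →
      ∀ t ∈ Icc (-b) T, ‖y t‖ ≤ R := by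
  obtain ⟨Φ, hΦ⟩ := (LocBddMeas.of_continuous hφ).exists_bound_Icc (-b) 0
  obtain ⟨G, hG⟩ := (LocBddMeas.of_continuous hg).exists_bound_Icc 0 T
  set L := 2 * c + ‖A‖ + 2 with hL
  set α := Φ ^ 2 + T * (‖f₀‖ ^ 2 + G ^ 2) + ‖A‖ * (b * Φ ^ 2) with hα
  have hα0 : 0 ≤ α := by positivity
  have hL0 : 0 ≤ L := by positivity
  have hAn := norm_nonneg A
  set B := α + (L + ‖A‖) * Real.exp ((L + ‖A‖) * T) * (T * α) with hB
  refine ⟨√B, fun τ hτ F hF hF0 hdis y hy hy0 heq t ht => ?_⟩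
  refine Real.le_sqrt_of_sq_le ?_
  have hαB : α ≤ B := le_add_of_nonneg_right (by positivity)
  have hhist : ∀ s ∈ Icc (-b) 0, ‖y s‖ ^ 2 ≤ Φ ^ 2 := fun s hs => by
    rw [hy0 s hs.2]
    have := hΦ s hs
    gcongr
  rcases le_or_gt t 0 with ht0 | ht0
  · refine (hhist t ⟨ht.1, ht0⟩).trans (le_trans ?_ hαB)
    have : 0 ≤ T * (‖f₀‖ ^ 2 + G ^ 2) + ‖A‖ * (b * Φ ^ 2) := by positivity
    linarith
  set k : ℝ → E := fun s => A (y (s - τ)) - (F (y s) - g s) with hk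
  have hkc : Continuous k := by fun_prop
  set Y : ℝ → E := fun t => φ 0 + ∫ s in 0..t, k s with hY
  have hYd : ∀ t, HasDerivAt Y (k t) t := fun t =>
    (intervalIntegral.integral_hasDerivAt_right (hkc.intervalIntegrable _ _)
      hkc.stronglyMeasurable.stronglyMeasurableAtFilter hkc.continuousAt).const_add _
  have hYc : Continuous Y := continuous_iff_continuousAt.mpr fun t => (hYd t).continuousAt
  have hYy : ∀ t ∈ Icc 0 T, y t = Y t := by
    intro t ht
    rcases eq_or_lt_of_le ht.1 with rfl | h0
    · simp [hY, hy0 0 le_rfl]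
    · exact heq t ⟨h0, ht.2⟩
  have hu : Continuous fun t => ‖y t‖ ^ 2 := by fun_prop
  have hum := LocBddMeas.of_continuous hu
  have henergy : ∀ r ∈ Icc 0 T, ‖y r‖ ^ 2 ≤ α + (L + ‖A‖) * ∫ s in 0..r, ‖y s‖ ^ 2 := by
    intro r hr
    have e₁ : ∫ s in 0..r, 2 * inner ℝ (Y s) (k s) = ‖Y r‖ ^ 2 - ‖Y 0‖ ^ 2 :=
      intervalIntegral.integral_eq_sub_of_hasDerivAt (fun s _ => (hYd s).norm_sq)
        (Continuous.intervalIntegrable (by fun_prop) _ _)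
    have e₂ : ∀ s ∈ Icc 0 r, 2 * inner ℝ (Y s) (k s) ≤
        (L * ‖y s‖ ^ 2 + ‖A‖ * ‖y (s - τ)‖ ^ 2) + (‖f₀‖ ^ 2 + G ^ 2) := by
      intro s hs
      have hs' : s ∈ Icc 0 T := ⟨hs.1, hs.2.trans hr.2⟩
      rw [← hYy s hs']
      have i₁ : inner ℝ (y s) (k s) = inner ℝ (y s) (A (y (s - τ))) - inner ℝ (F (y s) - F 0) (y s)
          - inner ℝ (y s) f₀ + inner ℝ (y s) (g s) := by
        rw [← hF0, real_inner_comm (y s) (F (y s) - F 0)]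
        simp only [hk, inner_sub_right]
        ring
      have i₂ := hdis (y s)
      have i₃ : inner ℝ (y s) (A (y (s - τ))) ≤ ‖y s‖ * (‖A‖ * ‖y (s - τ)‖) :=
        (real_inner_le_norm _ _).trans (mul_le_mul_of_nonneg_left (A.le_opNorm _) (norm_nonneg _))
      have i₄ : -inner ℝ (y s) f₀ ≤ ‖y s‖ * ‖f₀‖ :=
        (neg_le_abs _).trans (abs_real_inner_le_norm _ _)
      have i₅ : inner ℝ (y s) (g s) ≤ ‖y s‖ * G :=
        (real_inner_le_norm _ _).trans (mul_le_mul_of_nonneg_left (hG s hs') (norm_nonneg _))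
      have i₆ := mul_nonneg hAn (sq_nonneg (‖y s‖ - ‖y (s - τ)‖))
      have i₇ := sq_nonneg (‖y s‖ - ‖f₀‖)
      have i₈ := sq_nonneg (‖y s‖ - G)
      rw [i₁, hL]
      linarith
    have e₃ := intervalIntegral.integral_mono_on (μ := volume) hr.1
      (Continuous.intervalIntegrable (by fun_prop) _ _)
      (Continuous.intervalIntegrable (by fun_prop) _ _) e₂
    rw [e₁, intervalIntegral.integral_add (Continuous.intervalIntegrable (by fun_prop) _ _)
      (Continuous.intervalIntegrable (by fun_prop) _ _),
      intervalIntegral.integral_add (Continuous.intervalIntegrable (by fun_prop) _ _)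
      (Continuous.intervalIntegrable (by fun_prop) _ _), intervalIntegral.integral_const_mul,
      intervalIntegral.integral_const_mul, intervalIntegral.integral_const, sub_zero,
      smul_eq_mul] at e₃
    have e₄ := integral_comp_sub_le hum (fun t => sq_nonneg ‖y t‖) hτ.1 r
    have e₅ : ∫ s in -τ..0, ‖y s‖ ^ 2 ≤ b * Φ ^ 2 := by
      have := intervalIntegral.integral_mono_on (μ := volume) (show -τ ≤ 0 by linarith [hτ.1])
        (hum.intervalIntegrable _ _) (LocBddMeas.intervalIntegrable (.const (Φ ^ 2)) _ _)
        fun s hs => hhist s ⟨by linarith [hτ.2, hs.1], hs.2⟩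
      rw [intervalIntegral.integral_const, smul_eq_mul, zero_sub, neg_neg] at this
      exact this.trans (mul_le_mul_of_nonneg_right hτ.2 (sq_nonneg _))
    have e₆ : r * (‖f₀‖ ^ 2 + G ^ 2) ≤ T * (‖f₀‖ ^ 2 + G ^ 2) :=
      mul_le_mul_of_nonneg_right hr.2 (by positivity)
    have e₇ : ‖Y 0‖ ^ 2 ≤ Φ ^ 2 := by
      rw [← hYy 0 ⟨le_rfl, hT⟩]
      exact hhist 0 ⟨by linarith, le_rfl⟩
    have e₈ := mul_le_mul_of_nonneg_left (e₄.trans (add_le_add_left e₅ _)) hAn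
    rw [hYy r hr, hα]
    linarith
  have := gronwall_integral hum (.const α) (fun _ _ => hα0) (by positivity) henergy t ⟨ht0.le, ht.2⟩
  rwa [intervalIntegral.integral_const, sub_zero, smul_eq_mul] at this

/-- A nonlinearity that agrees with `f` near the ball of radius `R`, is bounded together with its
first two derivatives, and inherits the one-sided bound, so that its solutions satisfy the same
a priori bound. It multiplies `f - f 0` by a smooth cutoff with values in `[0, 1]`. -/
lemma exists_truncation [FiniteDimensional ℝ E] {f : E → E} (hf : ContDiff ℝ 2 f) {c : ℝ}
    (hc : 0 ≤ c) (hdis : ∀ p, -c * ‖p‖ ^ 2 ≤ inner ℝ (f p - f 0) p) (R : ℝ) :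
    ∃ (F : E → E) (K : ℝ), ContDiff ℝ 2 F ∧ (∀ p, ‖F p‖ ≤ K) ∧ (∀ p, ‖fderiv ℝ F p‖ ≤ K) ∧
      (∀ p, ‖fderiv ℝ (fderiv ℝ F) p‖ ≤ K) ∧ F 0 = f 0 ∧
      (∀ p, -c * ‖p‖ ^ 2 ≤ inner ℝ (F p - F 0) p) ∧ ∀ p, ‖p‖ ≤ R → F =ᶠ[𝓝 p] f := by
  let χ : ContDiffBump (0 : E) := ⟨|R| + 1, |R| + 2, by positivity, by linarith⟩
  set H : E → E := fun p => χ p • (f p - f 0) with hH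
  have hHc : ContDiff ℝ 2 H := χ.contDiff.smul (hf.sub contDiff_const)
  have hHs : HasCompactSupport H := χ.hasCompactSupport.smul_right
  obtain ⟨K, hK₀, hK₁, hK₂⟩ := exists_bounds_of_hasCompactSupport hHc hHs
  have hd : fderiv ℝ (fun p => f 0 + H p) = fderiv ℝ H := by
    ext1 p
    rw [fderiv_const_add]
  refine ⟨fun p => f 0 + H p, ‖f 0‖ + K, contDiff_const.add hHc, fun p => ?_,
    fun p => ?_, fun p => ?_, by simp [hH], fun p => ?_, fun p hp => ?_⟩
  · exact (norm_add_le _ _).trans (by linarith [hK₀ p])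
  · rw [hd]
    linarith [hK₁ p, norm_nonneg (f 0)]
  · rw [hd]
    linarith [hK₂ p, norm_nonneg (f 0)]
  · have e : f 0 + H p - (f 0 + H 0) = χ p • (f p - f 0) := by simp [hH]
    rw [e, inner_smul_left, conj_trivial]
    have h3 := mul_le_mul_of_nonneg_left (hdis p) (χ.nonneg (x := p))
    have h4 := mul_le_mul_of_nonneg_right (χ.le_one (x := p))
      (show 0 ≤ c * ‖p‖ ^ 2 by positivity)
    linarith
  · have hmem : p ∈ Metric.ball (0 : E) χ.rIn := by
      rw [mem_ball_zero_iff]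
      exact lt_of_le_of_lt (hp.trans (le_abs_self R)) (lt_add_one _)
    filter_upwards [χ.eventuallyEq_one_of_mem_ball hmem] with q hq
    simp [hH, hq]

end Existence

/-- Existence of the solutions for all delays and of the solutions of the linearised equations. -/
lemma exists_sensitivityFamily {E : Type*} [NormedAddCommGroup E] [NormedSpace ℝ E]
    [CompleteSpace E] (A : E →L[ℝ] E) {b T K R : ℝ} (hb : 0 ≤ b) (hT : 0 ≤ T) {f : E → E}
    (hf : ContDiff ℝ 2 f) (hK₀ : ∀ p, ‖f p‖ ≤ K) (hK₁ : ∀ p, ‖fderiv ℝ f p‖ ≤ K)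
    (hK₂ : ∀ p, ‖fderiv ℝ (fderiv ℝ f) p‖ ≤ K) {φ φt g : ℝ → E} (hφ : Continuous φ)
    (hφ0 : ∀ t, 0 ≤ t → φ t = φ 0) (hφt : Continuous φt)
    (hφeq : ∀ t ∈ Icc (-b) 0, φ t = φ 0 + ∫ s in 0..t, φt s) (hg : Continuous g)
    (hR : ∀ τ ∈ Icc 0 b, ∀ y : ℝ → E, Continuous y → (∀ t ≤ 0, y t = φ t) →
      (∀ t ∈ Ioc 0 T, y t = φ 0 + ∫ s in 0..t, (A (y (s - τ)) - (f (y s) - g s))) →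
      ∀ t ∈ Icc (-b) T, ‖y t‖ ≤ R) :
    ∃ x xt w v : ℝ → ℝ → E, SensitivityFamily A b T K R f φ φt g x xt w v := by
  have hK : 0 ≤ K := (norm_nonneg _).trans (hK₀ 0)
  have hfc := hf.continuous
  have hf₁ : ContDiff ℝ 1 (fderiv ℝ f) := hf.fderiv_right (by norm_num)
  have hf₁c := hf₁.continuous
  have hf₂c := hf₁.continuous_fderiv (by norm_num)
  have hx : ∀ σ ∈ Icc 0 b, ∃ y : ℝ → E, Continuous y ∧ (∀ t ≤ 0, y t = φ t) ∧
      ∀ t ∈ Ioc 0 T, y t = φ 0 + ∫ s in 0..t, (A (y (s - σ)) - (f (y s) - g s)) := by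
    intro σ hσ
    obtain ⟨y, -, h0, hc, heq⟩ := exists_delay_solution A hT hσ.1 hK (N := fun s a => f a - g s)
      (fun s p q => by
        rw [sub_sub_sub_cancel_right]
        exact convex_univ.norm_image_sub_le_of_norm_fderiv_le
          (fun r _ => hf.differentiable (by norm_num) r) (fun r _ => hK₁ r) (mem_univ q)
          (mem_univ p))
      (fun y hy => ⟨(hfc.comp_stronglyMeasurable hy.meas).sub hg.stronglyMeasurable, fun r => by
        obtain ⟨C, hC⟩ := (LocBddMeas.of_continuous hg).bdd r
        exact ⟨K + C, fun t ht => (norm_sub_le _ _).trans (add_le_add (hK₀ _) (hC t ht))⟩⟩)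
      (.of_continuous hφ)
    refine ⟨y, (hc.add hφ).congr fun t => sub_add_cancel _ _, h0, fun t ht => ?_⟩
    rw [← hφ0 t ht.1.le]
    exact heq t ⟨ht.1.le, ht.2⟩
  choose! x hxc hxh hxe using hx
  have hlin : ∀ σ ∈ Icc 0 b, ∀ y : ℝ → E, LocBddMeas y →
      LocBddMeas fun s => fderiv ℝ f (x σ s) (y s) := fun σ hσ y hy =>
    (LocBddMeas.of_continuous (hf₁c.comp (hxc σ hσ))).clm_apply hy
  have hlip : ∀ σ s p q, ‖fderiv ℝ f (x σ s) p - fderiv ℝ f (x σ s) q‖ ≤ K * ‖p - q‖ :=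
    fun σ s p q => by
      rw [← map_sub]
      exact (ContinuousLinearMap.le_opNorm _ _).trans
        (mul_le_mul_of_nonneg_right (hK₁ _) (norm_nonneg _))
  have hw : ∀ σ ∈ Icc 0 b, ∃ y : ℝ → E, Continuous y ∧ (∀ t ≤ 0, y t = 0) ∧
      ∀ t ∈ Ioc 0 T, y t = -A (x σ (t - σ) - φ (-σ)) +
        ∫ s in 0..t, (A (y (s - σ)) - fderiv ℝ f (x σ s) (y s)) := by
    intro σ hσ
    have := hxc σ hσ
    have hp : Continuous fun t => -A (x σ (max t 0 - σ) - φ (-σ)) := by fun_prop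
    obtain ⟨y, -, h0, hc, heq⟩ := exists_delay_solution A hT hσ.1 hK
      (N := fun s a => fderiv ℝ f (x σ s) a) (hlip σ) (hlin σ hσ) (.of_continuous hp)
    refine ⟨y, (hc.add hp).congr fun t => sub_add_cancel _ _, fun t ht => ?_, fun t ht => ?_⟩
    · rw [h0 t ht, max_eq_right ht, zero_sub, hxh σ hσ _ (by linarith [hσ.1]), sub_self, map_zero,
        neg_zero]
    · rw [heq t ⟨ht.1.le, ht.2⟩, max_eq_left ht.1.le]
  choose! w hwc hwh hwe using hw
  set xt : ℝ → ℝ → E := fun σ t =>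
    if t < 0 then φt t else A (x σ (t - σ)) - (f (x σ t) - g t) with hxt
  have hxtm : ∀ σ ∈ Icc 0 b, LocBddMeas (xt σ) := fun σ hσ => by
    have := hxc σ hσ
    exact LocBddMeas.ite (p := fun t : ℝ => t < 0) measurableSet_Iio (.of_continuous hφt)
      (.of_continuous (by fun_prop))
  have hv : ∀ σ ∈ Icc 0 b, ∃ y : ℝ → E, LocBddMeas y ∧ (∀ t ≤ 0, y t = 0) ∧
      ∀ t ∈ Ioc 0 T, y t = (A (xt σ (t - σ) - φt (-σ)) - (2 : ℝ) • A (w σ (t - σ))) +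
        ∫ s in 0..t, (A (y (s - σ)) - (fderiv ℝ f (x σ s) (y s) +
          fderiv ℝ (fderiv ℝ f) (x σ s) (w σ s) (w σ s))) := by
    intro σ hσ
    have hwm : LocBddMeas (w σ) := .of_continuous (hwc σ hσ)
    have hp : LocBddMeas fun t => A (xt σ (t - σ) - φt (-σ)) - (2 : ℝ) • A (w σ (t - σ)) :=
      (LocBddMeas.clm A (((hxtm σ hσ).comp_sub_right σ).sub (.const _))).sub
        (((hwm.comp_sub_right σ).clm A).const_smul 2)
    have hq : LocBddMeas fun s => fderiv ℝ (fderiv ℝ f) (x σ s) (w σ s) (w σ s) :=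
      ((LocBddMeas.of_continuous (hf₂c.comp (hxc σ hσ))).clm_apply hwm).clm_apply hwm
    obtain ⟨y, hy, h0, -, heq⟩ := exists_delay_solution A hT hσ.1 hK
      (N := fun s a => fderiv ℝ f (x σ s) a +
        fderiv ℝ (fderiv ℝ f) (x σ s) (w σ s) (w σ s))
      (fun s p q => by rw [add_sub_add_right_eq_sub]; exact hlip σ s p q)
      (fun y hy => (hlin σ hσ y hy).add hq)
      (LocBddMeas.ite (p := fun t : ℝ => t ≤ 0) measurableSet_Iic (.const 0) hp)
    refine ⟨y, hy, fun t ht => ?_, fun t ht => ?_⟩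
    · rw [h0 t ht, if_pos ht]
    · rw [heq t ⟨ht.1.le, ht.2⟩, if_neg (not_le.mpr ht.1)]
  choose! v hvm hvh hve using hv
  exact ⟨x, xt, w, v, hb, hT, hf, hK₀, hK₁, hK₂, hφt, hφeq, hg, hxc,
    fun σ hσ => hR σ hσ _ (hxc σ hσ) (hxh σ hσ) (hxe σ hσ), hxh, hxe, fun _ _ => rfl, hwc, hwh, hwe,
    hvm, hvh, hve⟩

/-! ### The impulsive equation and the jump -/

section Impulse

variable {E : Type*} [NormedAddCommGroup E] [NormedSpace ℝ E]

/-- Integration by parts against the primitive of an integrable function, by Fubini's theorem. -/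
lemma integral_deriv_smul_primitive [CompleteSpace E] {T : ℝ} {k : ℝ → E}
    (hk : IntegrableOn k (Ioo 0 T)) {ψ : ℝ → ℝ} (hψ : ContDiff ℝ ∞ ψ) :
    ∫ t in Ioo 0 T, deriv ψ t • ∫ s in 0..t, k s =
      ψ T • (∫ s in Ioo 0 T, k s) - ∫ s in Ioo 0 T, ψ s • k s := by
  have hψ' : Continuous (deriv ψ) := hψ.continuous_deriv (by simp)
  have hd : ∀ t, HasDerivAt ψ (deriv ψ t) t := fun t =>
    (hψ.differentiable (by simp) t).hasDerivAt
  set μ := (volume : Measure ℝ).restrict (Ioo 0 T) with hμ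
  have hψi : Integrable (deriv ψ) μ :=
    (hψ'.integrableOn_Icc (a := 0) (b := T)).mono_set Ioo_subset_Icc_self
  have hset : MeasurableSet {z : ℝ × ℝ | z.2 ≤ z.1} :=
    measurableSet_le measurable_snd measurable_fst
  have hprod : Integrable (Function.uncurry fun t s : ℝ =>
      ({z : ℝ × ℝ | z.2 ≤ z.1}.indicator fun z => deriv ψ z.1 • k z.2) (t, s)) (μ.prod μ) :=
    (hψi.smul_prod hk).indicator hset
  have e₁ : ∫ t in Ioo 0 T, deriv ψ t • ∫ s in 0..t, k s = ∫ t, ∫ s,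
      ({z : ℝ × ℝ | z.2 ≤ z.1}.indicator fun z => deriv ψ z.1 • k z.2) (t, s) ∂μ ∂μ := by
    refine setIntegral_congr_fun measurableSet_Ioo fun t ht => ?_
    have e : (fun s => ({z : ℝ × ℝ | z.2 ≤ z.1}.indicator fun z => deriv ψ z.1 • k z.2) (t, s)) =
        (Iic t).indicator fun s => deriv ψ t • k s := by
      ext s
      simp [indicator_apply]
    simp only [e]
    rw [integral_indicator measurableSet_Iic, hμ, Measure.restrict_restrict measurableSet_Iic,
      integral_smul, intervalIntegral.integral_of_le ht.1.le]
    have hs : Iic t ∩ Ioo 0 T = Ioc 0 t := by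
      ext s
      simp only [mem_inter_iff, mem_Iic, mem_Ioo, mem_Ioc]
      exact ⟨fun h => ⟨h.2.1, h.1⟩, fun h => ⟨h.2, h.1, h.2.trans_lt ht.2⟩⟩
    rw [hs]
  have e₂ : ∀ s ∈ Ioo 0 T, ∫ t,
      ({z : ℝ × ℝ | z.2 ≤ z.1}.indicator fun z => deriv ψ z.1 • k z.2) (t, s) ∂μ =
        (ψ T - ψ s) • k s := by
    intro s hs
    have e : (fun t => ({z : ℝ × ℝ | z.2 ≤ z.1}.indicator fun z => deriv ψ z.1 • k z.2) (t, s)) =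
        (Ici s).indicator fun t => deriv ψ t • k s := by
      ext t
      simp [indicator_apply]
    rw [e, integral_indicator measurableSet_Ici, hμ, Measure.restrict_restrict measurableSet_Ici,
      integral_smul_const]
    have hs' : Ici s ∩ Ioo 0 T = Ico s T := by
      ext t
      simp only [mem_inter_iff, mem_Ici, mem_Ioo, mem_Ico]
      exact ⟨fun h => ⟨h.1, h.2.2⟩, fun h => ⟨h.1, hs.1.trans_le h.1, h.2⟩⟩
    rw [hs', integral_Ico_eq_integral_Ioc, ← intervalIntegral.integral_of_le hs.2.le,
      intervalIntegral.integral_eq_sub_of_hasDerivAt (fun t _ => hd t)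
        (hψ'.intervalIntegrable _ _)]
  have hψk : Integrable (fun s => ψ s • k s) μ := by
    obtain ⟨C, hC⟩ := (LocBddMeas.of_continuous hψ.continuous).exists_bound_Icc 0 T
    exact Integrable.bdd_smul hk C hψ.continuous.aestronglyMeasurable
      (ae_restrict_of_forall_mem measurableSet_Ioo fun t ht => hC t (Ioo_subset_Icc_self ht))
  rw [e₁, integral_integral_swap hprod, hμ, setIntegral_congr_fun measurableSet_Ioo e₂]
  simp only [sub_smul]
  rw [integral_sub (hk.fun_smul (ψ T)) hψk, integral_smul]

end Impulse

/-- A function that vanishes up to time zero and is the primitive of `h - m` plus a jump `J` at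
time `τ` solves the impulsive equation. -/
lemma solvesImpulsiveEquation_of_primitive {n : ℕ} {b T τ : ℝ} (hb : 0 < b)
    (hτ : 0 ≤ τ) {J : Rn n} {m h v : ℝ → Rn n} (hv0 : ∀ t ≤ 0, v t = 0) (hv : LocBddMeas v)
    (hm : IntegrableOn m (Ioo 0 T)) (hh : IntegrableOn h (Ioo 0 T))
    (heq : ∀ t ∈ Ioc 0 T, v t = (∫ s in 0..t, (h s - m s)) + if τ ≤ t then J else 0) :
    SolvesImpulsiveEquation b T τ J m h v := by
  have hint : ∀ {u : ℝ → Rn n}, IntegrableOn u (Ioo 0 T) → ∀ t ∈ Ioc 0 T,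
      IntervalIntegrable u volume 0 t := fun hu t ht => by
    rw [intervalIntegrable_iff_integrableOn_Ioo_of_le ht.1.le]
    exact hu.mono_set (Ioo_subset_Ioo_right ht.2)
  refine ⟨fun t ht => hv0 t ht.2, (hv.integrableOn_Icc (-b) T).mono_set Ioo_subset_Icc_self,
    hm, hh, fun t ht => ?_, fun ψ hψ hψc hψs => ?_⟩
  · rw [heq t ht, intervalIntegral.integral_sub (hint hh t ht) (hint hm t ht), measureReal_def,
      Measure.dirac_apply' _ measurableSet_Iic]
    by_cases hτt : τ ≤ t
    · simp only [hτt, if_true, mem_Iic, indicator_of_mem, Pi.one_apply, ENNReal.toReal_one,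
        one_smul]
      abel
    · simp [hτt]
  have hψT : ψ T = 0 := image_eq_zero_of_notMem_tsupport fun hmem => lt_irrefl _ (hψs hmem).2
  have hψ' : Continuous (deriv ψ) := hψ.continuous_deriv (by simp)
  have hd : ∀ t, HasDerivAt ψ (deriv ψ t) t := fun t =>
    (hψ.differentiable (by simp) t).hasDerivAt
  have hψi : ∀ {u : ℝ → Rn n}, IntegrableOn u (Ioo 0 T) →
      IntegrableOn (fun s => ψ s • u s) (Ioo 0 T) := fun hu => by
    obtain ⟨C, hC⟩ := (LocBddMeas.of_continuous hψ.continuous).exists_bound_Icc 0 T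
    exact Integrable.bdd_smul hu C hψ.continuous.aestronglyMeasurable
      (ae_restrict_of_forall_mem measurableSet_Ioo fun t ht => hC t (Ioo_subset_Icc_self ht))
  have e₁ : ∫ t in Ioo (-b) T, deriv ψ t • v t = ∫ t in Ioo 0 T, deriv ψ t • v t := by
    refine (setIntegral_eq_of_subset_of_forall_sdiff_eq_zero measurableSet_Ioo
      (Ioo_subset_Ioo_left (by linarith)) fun t ht => ?_)
    have : t ≤ 0 := by
      by_contra h0
      exact ht.2 ⟨not_le.mp h0, ht.1.2⟩
    rw [hv0 t this, smul_zero]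
  have hjm : LocBddMeas fun t => deriv ψ t • (if τ ≤ t then J else 0) :=
    LocBddMeas.clm_apply (L := fun t => deriv ψ t • ContinuousLinearMap.id ℝ (Rn n))
      (.of_continuous (by fun_prop))
      (.ite (p := fun t : ℝ => τ ≤ t) measurableSet_Ici (.const J) (.const 0))
  have hjump : ∫ t in Ioo 0 T, deriv ψ t • (if τ ≤ t then J else 0) = -(ψ τ • J) := by
    rcases lt_or_ge τ T with hτT | hτT
    · have e : (fun t => deriv ψ t • (if τ ≤ t then J else 0)) =
          (Ici τ).indicator fun t => deriv ψ t • J := by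
        ext1 t
        by_cases hτt : τ ≤ t <;> simp [hτt]
      rw [e, ← integral_Ioc_eq_integral_Ioo, setIntegral_indicator measurableSet_Ici]
      have hae : (Ioc 0 T ∩ Ici τ : Set ℝ) =ᵐ[volume] (Ioc τ T : Set ℝ) := by
        have h1 : (Ioc τ T : Set ℝ) ⊆ Ioc 0 T ∩ Ici τ := fun t ht =>
          ⟨⟨hτ.trans_lt ht.1, ht.2⟩, ht.1.le⟩
        have h2 : (Ioc 0 T ∩ Ici τ : Set ℝ) ⊆ Icc τ T := fun t ht => ⟨ht.2, ht.1.2⟩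
        exact (h2.eventuallyLE.trans Ioc_ae_eq_Icc.symm.le).antisymm h1.eventuallyLE
      rw [setIntegral_congr_set hae, integral_smul_const,
        ← intervalIntegral.integral_of_le hτT.le,
        intervalIntegral.integral_eq_sub_of_hasDerivAt (fun t _ => hd t)
          (hψ'.intervalIntegrable _ _), hψT, zero_sub, neg_smul]
    · have hψτ : ψ τ = 0 :=
        image_eq_zero_of_notMem_tsupport fun hmem => not_lt.mpr hτT (hψs hmem).2
      rw [hψτ, zero_smul, neg_zero]
      refine (setIntegral_congr_fun measurableSet_Ioo fun t ht => ?_).trans (integral_zero ℝ (Rn n))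
      rw [if_neg (not_le.mpr (ht.2.trans_le hτT)), smul_zero]
  have hk : IntegrableOn (fun s => h s - m s) (Ioo 0 T) := hh.sub hm
  have e₂ : ∫ t in Ioo 0 T, deriv ψ t • v t =
      (∫ t in Ioo 0 T, deriv ψ t • ∫ s in 0..t, (h s - m s)) +
        ∫ t in Ioo 0 T, deriv ψ t • (if τ ≤ t then J else 0) := by
    have e : ∀ t ∈ Ioo 0 T, deriv ψ t • v t = deriv ψ t • (∫ s in 0..t, (h s - m s)) +
        deriv ψ t • (if τ ≤ t then J else 0) := fun t ht => by
      rw [heq t ⟨ht.1, ht.2.le⟩, smul_add]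
    have hvi : IntegrableOn (fun t => deriv ψ t • v t) (Ioo 0 T) :=
      ((LocBddMeas.clm_apply (L := fun t => deriv ψ t • ContinuousLinearMap.id ℝ (Rn n))
        (.of_continuous (by fun_prop)) hv).integrableOn_Icc 0 T).mono_set Ioo_subset_Icc_self
    have hji : IntegrableOn (fun t => deriv ψ t • (if τ ≤ t then J else 0)) (Ioo 0 T) :=
      (hjm.integrableOn_Icc 0 T).mono_set Ioo_subset_Icc_self
    rw [← integral_add _ hji, setIntegral_congr_fun measurableSet_Ioo e]
    refine (hvi.sub hji).congr_fun (fun t ht => ?_) measurableSet_Ioo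
    simp only [Pi.sub_apply]
    rw [e t ht, add_sub_cancel_right]
  rw [e₁, e₂, hjump, integral_deriv_smul_primitive hk hψ, hψT, zero_smul, zero_sub,
    integral_dirac]
  simp only [smul_sub]
  rw [integral_sub (hψi hh) (hψi hm)]
  abel

/-- The one-sided limits of a primitive plus a jump. -/
lemma exists_jump_of_primitive {n : ℕ} {T τ : ℝ} (hT : 0 < T) (hτ : 0 ≤ τ) (hτT : τ < T)
    {J : Rn n} {k v : ℝ → Rn n} (hv0 : ∀ t ≤ 0, v t = 0) (hk : IntegrableOn k (Ioo 0 T))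
    (heq : ∀ t ∈ Ioc 0 T, v t = (∫ s in 0..t, k s) + if τ ≤ t then J else 0) :
    ∃ l r : Rn n, Tendsto v (𝓝[<] τ) (𝓝 l) ∧ Tendsto v (𝓝[>] τ) (𝓝 r) ∧ r - l = J := by
  set H : ℝ → Rn n := fun t => ∫ s in 0..t, k s with hH
  have hkI : IntegrableOn k (uIcc 0 T) := by
    rw [uIcc_of_le hT.le]
    exact hk.congr_set_ae Ioo_ae_eq_Icc.symm
  have hHc : ContinuousOn H (Icc 0 T) := by
    simpa [uIcc_of_le hT.le] using intervalIntegral.continuousOn_primitive_interval hkI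
  have hHτ := hHc τ ⟨hτ, hτT.le⟩
  refine ⟨H τ, H τ + J, ?_, ?_, add_sub_cancel_left _ _⟩
  · rcases eq_or_lt_of_le hτ with rfl | hτ0
    · have : H 0 = 0 := by simp [hH]
      rw [this]
      exact tendsto_const_nhds.congr' (eventually_mem_nhdsWithin.mono fun t ht =>
        (hv0 t (le_of_lt ht)).symm)
    · have h1 : Tendsto H (𝓝[Ioo 0 τ] τ) (𝓝 (H τ)) :=
        hHτ.mono fun t ht => ⟨ht.1.le, ht.2.le.trans hτT.le⟩
      rw [← nhdsWithin_Ioo_eq_nhdsLT hτ0]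
      refine h1.congr' (eventually_mem_nhdsWithin.mono fun t ht => ?_)
      rw [heq t ⟨ht.1, ht.2.le.trans hτT.le⟩, if_neg (not_le.mpr ht.2), add_zero]
  · have h1 : Tendsto H (𝓝[Ioo τ T] τ) (𝓝 (H τ)) :=
      hHτ.mono fun t ht => ⟨hτ.trans ht.1.le, ht.2.le⟩
    rw [← nhdsWithin_Ioo_eq_nhdsGT hτT]
    refine (h1.add_const J).congr' (eventually_mem_nhdsWithin.mono fun t ht => ?_)
    rw [heq t ⟨hτ.trans_lt ht.1, ht.2.le⟩, if_pos ht.1.le]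

/-! ### Continuous extensions of the data -/

lemma continuous_comp_clamp {F : Type*} [TopologicalSpace F] {u : ℝ → F} {a c : ℝ} (hac : a ≤ c)
    (hu : ContinuousOn u (Icc a c)) : Continuous fun t => u (max a (min t c)) :=
  hu.comp_continuous (by fun_prop) fun t => ⟨le_max_left _ _, max_le hac (min_le_right _ _)⟩

lemma clamp_of_mem {a c t : ℝ} (ht : t ∈ Icc a c) : max a (min t c) = t := by
  rw [min_eq_left ht.2, max_eq_right ht.1]

namespace HasH1Deriv

variable {n : ℕ} {a c : ℝ} {u v : ℝ → Rn n}

lemma integrableOn_Icc (h : HasH1Deriv a c u v) : IntegrableOn v (Icc a c) :=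
  IntegrableOn.congr_set_ae (h.1.integrable one_le_two) Ioo_ae_eq_Icc.symm

lemma intervalIntegrable (h : HasH1Deriv a c u v) {r s : ℝ} (hr : r ∈ Icc a c)
    (hs : s ∈ Icc a c) : IntervalIntegrable v volume r s :=
  (h.integrableOn_Icc.mono_set
    ((convex_Icc a c).ordConnected.uIcc_subset hr hs)).intervalIntegrable

lemma continuousOn (h : HasH1Deriv a c u v) : ContinuousOn u (Icc a c) := by
  rcases le_or_gt a c with hac | hac
  · have h1 := h.integrableOn_Icc
    rw [← uIcc_of_le hac] at h1
    have h2 := intervalIntegral.continuousOn_primitive_interval h1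
    rw [uIcc_of_le hac] at h2
    exact (continuousOn_const.add h2).congr h.2
  · rw [Icc_eq_empty (not_le.mpr hac)]
    exact continuousOn_empty _

lemma sub_eq (h : HasH1Deriv a c u v) {r s : ℝ} (hr : r ∈ Icc a c) (hs : s ∈ Icc a c) :
    u s - u r = ∫ t in r..s, v t := by
  have ha : a ∈ Icc a c := ⟨le_rfl, hr.1.trans hr.2⟩
  rw [h.2 s hs, h.2 r hr, add_sub_add_left_eq_sub, intervalIntegral.integral_interval_sub_left
    (h.intervalIntegrable ha hs) (h.intervalIntegrable ha hr)]

end HasH1Deriv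

/-! ### Uniqueness and time regularity -/

namespace SensitivityFamily

variable {E : Type*} [NormedAddCommGroup E] [NormedSpace ℝ E] [CompleteSpace E]
variable {A : E →L[ℝ] E} {b T K R : ℝ} {f : E → E} {φ φt g : ℝ → E} {x xt w v : ℝ → ℝ → E}

theorem eq_x_of_solution (h : SensitivityFamily A b T K R f φ φt g x xt w v) {τ : ℝ}
    (hτ : τ ∈ Icc 0 b) {y : ℝ → E} (hy : Continuous y) (hy0 : ∀ t ≤ 0, y t = φ t)
    (heq : ∀ t ∈ Ioc 0 T, y t = φ 0 + ∫ s in 0..t, (A (y (s - τ)) - (f (y s) - g s))) :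
    ∀ t ≤ T, y t = x τ t := by
  intro t ht
  have hym := LocBddMeas.of_continuous hy
  have hfm : LocBddMeas fun s => f (y s) - g s :=
    .of_continuous ((h.f_contDiff.continuous.comp hy).sub h.g_cont)
  have := delay_bound (A := A) (a := fun _ => 0) (c₁ := 0) (c₂ := 0) (K := K) (T := T) (σ := τ)
    (k := fun s => (f (y s) - g s) - (f (x τ s) - g s)) (hym.sub (h.x_meas hτ))
    (fun t ht => by rw [hy0 t ht, h.x_hist τ hτ t ht, sub_self]) hτ.1
    (.const 0) h.K_nonneg h.T_nonneg le_rfl le_rfl (fun _ _ => by simp) (fun s _ => ?_)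
    (fun t ht => ?_) t ht
  · rw [mul_zero, add_zero, mul_zero] at this
    exact sub_eq_zero.mp (norm_le_zero_iff.mp this)
  · rw [sub_sub_sub_cancel_right, add_zero]
    exact h.f_lipschitz _ _
  · rw [delay_sub_eq A (q₁ := fun _ => φ 0) (q₂ := fun _ => φ 0) hym (h.x_meas hτ) hfm
      (h.force_x_meas hτ) (heq t ht) (h.x_eq τ hτ t ht)]
    simp

/-- The integral of a shifted time derivative. -/
lemma integral_xt_shift (h : SensitivityFamily A b T K R f φ φt g x xt w v) {τ t : ℝ}
    (hτ : τ ∈ Icc 0 b) (ht : t ∈ Icc 0 T) :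
    ∫ s in 0..t, A (xt τ (s - τ)) = A (x τ (t - τ) - x τ (-τ)) := by
  rw [h.x_sub_eq hτ (h.sub_mem hτ ht) (h.neg_mem hτ)]
  have := integral_delay A (h.xt_meas hτ) (.const 0) τ t
  simpa using this

lemma w_eq_primitive (h : SensitivityFamily A b T K R f φ φt g x xt w v) {τ t : ℝ}
    (hτ : τ ∈ Icc 0 b) (ht : t ∈ Icc 0 T) :
    w τ t = ∫ s in 0..t,
      (A (w τ (s - τ)) - fderiv ℝ f (x τ s) (w τ s) - A (xt τ (s - τ))) := by
  rcases eq_or_lt_of_le ht.1 with rfl | ht0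
  · rw [h.w_hist τ hτ 0 le_rfl, intervalIntegral.integral_same]
  rw [intervalIntegral.integral_sub
    (((((h.w_meas hτ).comp_sub_right τ).clm A).sub (h.force_w_meas hτ)).intervalIntegrable _ _)
    ((((h.xt_meas hτ).comp_sub_right τ).clm A).intervalIntegrable _ _), h.integral_xt_shift hτ ht,
    h.w_eq τ hτ t ⟨ht0, ht.2⟩, h.x_hist τ hτ (-τ) (by linarith [hτ.1])]
  abel

/-- The equation for `xt τ` differentiated in time, on `[0, T]`. -/
lemma xt_eq_primitive (h : SensitivityFamily A b T K R f φ φt g x xt w v) {τ t : ℝ}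
    (hτ : τ ∈ Icc 0 b) (ht : t ∈ Icc 0 T) {gt : ℝ → E} (hgt : IntegrableOn gt (Icc 0 T))
    (hg : g t - g 0 = ∫ s in 0..t, gt s) :
    xt τ t = xt τ 0 + ∫ s in 0..t,
      (A (xt τ (s - τ)) - (fderiv ℝ f (x τ s) (xt τ s) - gt s)) := by
  have hlin : LocBddMeas fun s => fderiv ℝ f (x τ s) (xt τ s) :=
    (h.fderiv_x_meas hτ).clm_apply (h.xt_meas hτ)
  have hgi : IntervalIntegrable gt volume 0 t :=
    (hgt.mono_set (by rw [uIcc_of_le ht.1]; exact Icc_subset_Icc_right ht.2)).intervalIntegrable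
  have hf : ∫ s in 0..t, fderiv ℝ f (x τ s) (xt τ s) = f (x τ t) - f (x τ 0) := by
    refine intervalIntegral.integral_eq_sub_of_hasDerivAt_of_le (f := fun s => f (x τ s)) ht.1
      (h.f_contDiff.continuous.comp (h.x_cont τ hτ)).continuousOn (fun s hs => ?_)
      (hlin.intervalIntegrable _ _)
    have hsT : s < T := hs.2.trans_le ht.2
    have hd := (h.hasDerivWithinAt_x_time hτ (h.mem_of_mem ⟨hs.1.le, hsT.le⟩) hs.1.ne').hasDerivAt
      (Icc_mem_nhds (by linarith [h.b_nonneg, hs.1]) hsT)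
    exact (h.f_differentiable (x τ s)).hasFDerivAt.comp_hasDerivAt s hd
  rw [intervalIntegral.integral_sub ((((h.xt_meas hτ).comp_sub_right τ).clm A).intervalIntegrable
    _ _) ((hlin.intervalIntegrable _ _).sub hgi),
    intervalIntegral.integral_sub (hlin.intervalIntegrable _ _) hgi, h.integral_xt_shift hτ ht, hf,
    ← hg, h.xt_eq, h.xt_eq, if_neg (not_lt.mpr ht.1), if_neg (lt_irrefl _), zero_sub, map_sub]
  abel

end SensitivityFamily

namespace SensitivityFamily

variable {n : ℕ} {A : Rn n →L[ℝ] Rn n} {b T K R : ℝ} {f : Rn n → Rn n} {φ φt g : ℝ → Rn n}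
  {x xt w v : ℝ → ℝ → Rn n}

/-! ### Regularity in `L²` with respect to the delay -/

theorem isTwiceContDiffL2 (h : SensitivityFamily A b T K R f φ φt g x xt w v) :
    IsTwiceContDiffL2 b T x w v := by
  set μ := (volume : Measure ℝ).restrict (Ioo (-b) T) with hμ
  have hrep : ∀ {u : ℝ → ℝ → Rn n}, (∀ τ ∈ Icc 0 b, LocBddMeas (u τ)) →
      ∀ τ ∈ Icc 0 b, ∃ U : L2Space n b T, U =ᵐ[μ] u τ := fun hu τ hτ =>
    ⟨((hu τ hτ).memLp_Ioo (-b) T).toLp _, MemLp.coeFn_toLp _⟩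
  have hae : ∀ {p : ℝ → Prop}, (∀ t ≤ T, p t) → ∀ᵐ t ∂μ, p t := fun hp =>
    ae_restrict_of_forall_mem measurableSet_Ioo fun t ht => hp t ht.2.le
  have haene : ∀ {p : ℝ → Prop} {τ : ℝ}, (∀ t ≤ T, t ≠ τ → p t) → ∀ᵐ t ∂μ, p t := fun {p τ} hp => by
    filter_upwards [hae (p := (· ≤ T)) fun t ht => ht, Measure.ae_ne μ τ] with t ht hne
    exact hp t ht hne
  choose! X hX using hrep fun τ hτ => h.x_meas hτ
  choose! W hW using hrep fun τ hτ => h.w_meas hτ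
  choose! V hV using hrep h.v_meas
  obtain ⟨C₁, hC₁, h₁⟩ := h.exists_x_delay_lipschitz
  obtain ⟨C₂, hC₂, h₂⟩ := h.exists_w_le
  obtain ⟨C₃, hC₃, h₃⟩ := h.exists_w_delay_lipschitz
  obtain ⟨C₄, hC₄, h₄⟩ := h.exists_v_le
  have hzero : ∀ {u : ℝ → Rn n} {U : L2Space n b T}, U =ᵐ[μ] u → (∀ t ≤ 0, u t = 0) →
      U ∈ L2Zero n b T := fun {u U} hU hu => by
    change ∀ᵐ t ∂μ, t < 0 → U t = 0
    filter_upwards [hU] with t ht ht0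
    rw [ht, hu t ht0.le]
  have hle : ∀ {a c d σ τ : ℝ}, 0 ≤ c → d ≤ a * |σ - τ| → d ≤ (a + c) * |σ - τ| :=
    fun hc hd => hd.trans (mul_le_mul_of_nonneg_right (by linarith) (abs_nonneg _))
  refine ⟨X, W, V, fun τ hτ => ⟨hX τ hτ, hW τ hτ, hV τ hτ, hzero (hW τ hτ) (h.w_hist τ hτ),
    hzero (hV τ hτ) (h.v_hist τ hτ), ?_, ?_⟩, fun τ hτ => ?_⟩
  · exact hasDerivWithinAt_Lp_two (C := C₁ + C₂) hX hτ (hW τ hτ)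
      (fun σ hσ => hae fun t ht => hle hC₂ (h₁ σ hσ τ hτ t ht))
      (hae fun t ht => (h₂ τ hτ t ht).trans (by linarith)) (hae (h.hasDerivWithinAt_x hτ))
  · exact hasDerivWithinAt_Lp_two (C := C₃ + C₄) hW hτ (hV τ hτ)
      (fun σ hσ => hae fun t ht => hle hC₄ (h₃ σ hσ τ hτ t ht))
      (hae fun t ht => (h₄ τ hτ t ht).trans (by linarith)) (haene (h.hasDerivWithinAt_w hτ))
  · exact tendsto_Lp_two_of_bounded (C := C₄) (eventually_mem_nhdsWithin.mono hV) (hV τ hτ)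
      (eventually_mem_nhdsWithin.mono fun σ hσ => hae (h₄ σ hσ)) (hae (h₄ τ hτ))
      (haene (h.tendsto_v hτ))

/-- The shifted time derivative is the integral of the second time derivative `xtt`, taken on both
sides of zero, plus the jump of `xt` at zero, once the shifted time has passed zero. -/
lemma xt_shift_eq (h : SensitivityFamily A b T K R f φ φt g x xt w v) {τ t : ℝ}
    (hτ : τ ∈ Icc 0 b) (ht : t ∈ Icc 0 T) {xtt : ℝ → Rn n} (hi : IntegrableOn xtt (Icc (-b) T))
    (hneg : ∀ r ∈ Icc (-b) 0, φt 0 - φt r = ∫ s in r..0, xtt s)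
    (hpos : ∀ r ∈ Icc 0 T, xt τ r = xt τ 0 + ∫ s in 0..r, xtt s) :
    xt τ (t - τ) - φt (-τ) =
      (∫ s in 0..t, xtt (s - τ)) + if τ ≤ t then xt τ 0 - φt 0 else 0 := by
  have hint : ∀ {r s}, r ∈ Icc (-b) T → s ∈ Icc (-b) T → IntervalIntegrable xtt volume r s :=
    fun hr hs => (hi.mono_set
      ((convex_Icc _ _).ordConnected.uIcc_subset hr hs)).intervalIntegrable
  have h0 : (0 : ℝ) ∈ Icc (-b) T := h.mem_of_mem ⟨le_rfl, h.T_nonneg⟩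
  have hnegτ := hneg (-τ) ⟨by linarith [hτ.2], by linarith [hτ.1]⟩
  rw [intervalIntegral.integral_comp_sub_right xtt τ, zero_sub,
    ← intervalIntegral.integral_add_adjacent_intervals (hint (h.neg_mem hτ) h0)
      (hint h0 (h.sub_mem hτ ht)), ← hnegτ]
  split_ifs with hτt
  · rw [hpos (t - τ) ⟨by linarith, by linarith [ht.2, hτ.1]⟩]
    abel
  · have e := hneg (t - τ) ⟨(h.sub_mem hτ ht).1, by linarith⟩
    rw [h.xt_eq, if_pos (by linarith), intervalIntegral.integral_symm (t - τ) 0, ← e]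
    abel

/-- The equation for `v τ` with the integral of the shifted time derivative carried out backwards:
the impulse at time `τ` comes from the jump of the time derivative of the solution at zero. -/
lemma v_eq_primitive (h : SensitivityFamily A b T K R f φ φt g x xt w v) {τ t : ℝ}
    (hτ : τ ∈ Icc 0 b) (ht : t ∈ Ioc 0 T) {xtt wt : ℝ → Rn n}
    (hi : IntegrableOn xtt (Icc (-b) T))
    (hneg : ∀ r ∈ Icc (-b) 0, φt 0 - φt r = ∫ s in r..0, xtt s)
    (hpos : ∀ r ∈ Icc 0 T, xt τ r = xt τ 0 + ∫ s in 0..r, xtt s)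
    (hwt : LocBddMeas wt) (hw : ∀ r ∈ Icc (-b) T, w τ r = ∫ s in 0..r, wt s) :
    v τ t = (∫ s in 0..t, ((A (v τ (s - τ)) - (2 : ℝ) • A (wt (s - τ)) + A (xtt (s - τ))) -
      (fderiv ℝ f (x τ s) (v τ s) + fderiv ℝ (fderiv ℝ f) (x τ s) (w τ s) (w τ s)))) +
        if τ ≤ t then A (xt τ 0 - φt 0) else 0 := by
  have ht' : t ∈ Icc 0 T := ⟨ht.1.le, ht.2⟩
  have hxs : IntervalIntegrable (fun s => xtt (s - τ)) volume 0 t := by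
    have := (hi.mono_set ((convex_Icc _ _).ordConnected.uIcc_subset (h.neg_mem hτ)
      (h.sub_mem hτ ht'))).intervalIntegrable.comp_sub_right τ
    simpa using this
  have hAx : IntervalIntegrable (fun s => A (xtt (s - τ))) volume 0 t :=
    ⟨A.integrable_comp hxs.1, A.integrable_comp hxs.2⟩
  have hvs := ((h.v_meas τ hτ).comp_sub_right τ).clm A
  have hws := (hwt.comp_sub_right τ).clm A
  have e₁ : ∫ s in 0..t, A (xtt (s - τ)) = A (∫ s in 0..t, xtt (s - τ)) :=
    A.intervalIntegral_comp_comm hxs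
  have e₂ : ∫ s in 0..t, A (wt (s - τ)) = A (w τ (t - τ)) := by
    have e := integral_delay A hwt (.const 0) τ t
    rw [← hw _ (h.sub_mem hτ ht'), ← hw _ (h.neg_mem hτ),
      h.w_hist τ hτ (-τ) (by linarith [hτ.1])] at e
    simpa using e
  have e₃ := h.xt_shift_eq hτ ht' hi hneg hpos
  rw [h.v_eq τ hτ t ht, e₃, intervalIntegral.integral_sub
    (((hvs.sub (hws.const_smul 2)).intervalIntegrable _ _).add hAx)
    ((h.force_v_meas hτ).intervalIntegrable _ _), intervalIntegral.integral_add
    ((hvs.sub (hws.const_smul 2)).intervalIntegrable _ _) hAx,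
    intervalIntegral.integral_sub (hvs.intervalIntegrable _ _)
    ((hws.const_smul 2).intervalIntegrable _ _), intervalIntegral.integral_smul,
    intervalIntegral.integral_sub (hvs.intervalIntegrable _ _)
    ((h.force_v_meas hτ).intervalIntegrable _ _), e₁, e₂, map_add]
  split_ifs
  · abel
  · rw [map_zero]
    abel

end SensitivityFamily

/-! ### Solutions of the delay equation and their sensitivity -/

/-- The delay equation in integrated form, for the extension of a solution by constants. -/
lemma IsDelaySolution.eq_integral {n : ℕ} {f : Rn n → Rn n} {A : Rn n →L[ℝ] Rn n}
    {g φ : ℝ → Rn n} {b T τ : ℝ} {y : ℝ → Rn n} (hy : IsDelaySolution f A g φ b T τ y)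
    (hb : 0 < b) (hτ : τ ∈ Icc 0 b) {t : ℝ} (ht : t ∈ Ioc 0 T) :
    y t = φ 0 + ∫ s in 0..t, (A (y (max (-b) (min (s - τ) T))) -
      (f (y (max (-b) (min s T))) - g (max 0 (min s T)))) := by
  obtain ⟨-, hy0, u, hu, hae⟩ := hy
  rw [hu.2 t ⟨ht.1.le, ht.2⟩, hy0 ⟨by linarith, le_rfl⟩]
  congr 1
  refine intervalIntegral.integral_congr_ae ?_
  have h1 := (ae_restrict_iff' measurableSet_Ioo).mp hae
  filter_upwards [h1, Measure.ae_ne volume T] with s hs hsT hst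
  rw [uIoc_of_le ht.1.le] at hst
  have hsT' : s < T := lt_of_le_of_ne (hst.2.trans ht.2) hsT
  rw [clamp_of_mem (t := s - τ) ⟨by linarith [hst.1, hτ.2], by linarith [hτ.1]⟩,
    clamp_of_mem (t := s) ⟨by linarith [hst.1], hsT'.le⟩,
    clamp_of_mem (a := 0) (t := s) ⟨hst.1.le, hsT'.le⟩, eq_sub_of_add_eq (hs ⟨hst.1, hsT'⟩)]
  abel

theorem theorem5p3 (n : ℕ) (b T : ℝ) (hb : 0 < b) (hT : 0 < T)
    (f : Rn n → Rn n) (hf : ContDiff ℝ 2 f)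
    (hmono : ∃ c : ℝ, 0 < c ∧ ∀ p y : Rn n, 0 ≤ inner ℝ (fderiv ℝ f p y + c • y) y)
    (M : Matrix (Fin n) (Fin n) ℝ) (A : Rn n →L[ℝ] Rn n)
    (hA : A = Matrix.toEuclideanCLM (𝕜 := ℝ) M)
    -- `φ ∈ H²(-b, 0)` with derivatives `φt`, `φtt`, and `g ∈ H¹(0, T)` with derivative `gt`
    (φ φt φtt : ℝ → Rn n) (hφ : HasH1Deriv (-b) 0 φ φt) (hφt : HasH1Deriv (-b) 0 φt φtt)
    (g gt : ℝ → Rn n) (hg : HasH1Deriv 0 T g gt) :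
    -- `x τ = x[τ]`, `w τ = x'[τ]`, `v τ = x''[τ]`; a suffix `t` is a derivative in time;
    -- `d τ` is the right-hand limit of the time derivative of `x[τ]` at `0`
    ∃ (x xt xtt w wt v : ℝ → ℝ → Rn n) (d : ℝ → Rn n),
      (∀ τ ∈ Icc 0 b, IsDelaySolution f A g φ b T τ (x τ) ∧
        ∀ y : ℝ → Rn n, IsDelaySolution f A g φ b T τ y → EqOn y (x τ) (Icc (-b) T)) ∧
      IsTwiceContDiffL2 b T x w v ∧
      ∀ τ ∈ Icc 0 b,
        -- time derivatives of `x[τ]`; the second one is taken separately on both sides of `0`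
        HasH1Deriv (-b) T (x τ) (xt τ) ∧ HasH1Deriv 0 T (xt τ) (xtt τ) ∧
        (∀ t ∈ Ico (-b) 0, xt τ t = φt t ∧ xtt τ t = φtt t) ∧
        Tendsto (xt τ) (𝓝[>] 0) (𝓝 (d τ)) ∧
        -- time derivative of `x'[τ]`
        HasH1Deriv (-b) T (w τ) (wt τ) ∧ (∀ t ∈ Icc (-b) 0, w τ t = 0) ∧
        -- the delay equation with impulse for `x''[τ]`
        SolvesImpulsiveEquation b T τ (A (d τ - φt 0))
          (fun t => fderiv ℝ f (x τ t) (v τ t) +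
            fderiv ℝ (fderiv ℝ f) (x τ t) (w τ t) (w τ t))
          (fun t => A (v τ (t - τ)) - (2 : ℝ) • A (wt τ (t - τ)) + A (xtt τ (t - τ)))
          (v τ) ∧
        -- the jump at `t = τ`
        (τ < T → ∃ l r : Rn n, Tendsto (v τ) (𝓝[<] τ) (𝓝 l) ∧
          Tendsto (v τ) (𝓝[>] τ) (𝓝 r) ∧ r - l = A (d τ - φt 0)) ∧
        -- it vanishes under the compatibility condition
        (φt 0 = -f (φ 0) + A (φ (-τ)) + g 0 → A (d τ - φt 0) = 0) := by
  obtain ⟨c, hc, hmono⟩ := hmono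
  have hb0 : -b ≤ 0 := by linarith
  -- Extensions of the data by constants, so that all functions are defined on the whole line.
  set φ' : ℝ → Rn n := fun t => φ (max (-b) (min t 0)) with hφ'
  set φt' : ℝ → Rn n := fun t => φt (max (-b) (min t 0)) with hφt'
  set g' : ℝ → Rn n := fun t => g (max 0 (min t T)) with hg'
  have hφc : Continuous φ' := continuous_comp_clamp hb0 hφ.continuousOn
  have hφtc : Continuous φt' := continuous_comp_clamp hb0 hφt.continuousOn
  have hgc : Continuous g' := continuous_comp_clamp hT.le hg.continuousOn
  have hφe : ∀ t ∈ Icc (-b) 0, φ' t = φ t := fun t ht => by simp only [hφ', clamp_of_mem ht]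
  have hφte : ∀ t ∈ Icc (-b) 0, φt' t = φt t := fun t ht => by simp only [hφt', clamp_of_mem ht]
  have hge : ∀ t ∈ Icc 0 T, g' t = g t := fun t ht => by simp only [hg', clamp_of_mem ht]
  have h00 : (0 : ℝ) ∈ Icc (-b) 0 := ⟨hb0, le_rfl⟩
  have hφ0 : ∀ t, 0 ≤ t → φ' t = φ' 0 := fun t ht => by
    simp only [hφ', min_eq_right ht, min_self]
  have hφeq : ∀ t ∈ Icc (-b) 0, φ' t = φ' 0 + ∫ s in 0..t, φt' s := fun t ht => by
    rw [hφe t ht, hφe 0 h00, ← sub_eq_iff_eq_add', hφ.sub_eq h00 ht]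
    refine intervalIntegral.integral_congr fun s hs => (hφte s ?_).symm
    rw [uIcc_of_ge ht.2] at hs
    exact ⟨ht.1.trans hs.1, hs.2⟩
  -- The a priori bound holds for `f` and for its truncation `F`.
  have hdis := neg_mul_norm_sq_le_inner (hf.differentiable (by norm_num)) hmono
  obtain ⟨R, hR⟩ := exists_delay_a_priori_bound A hb.le hT.le hc.le (f 0) hφc hgc
  obtain ⟨F, K, hF, hK₀, hK₁, hK₂, hF0, hFdis, hFf⟩ := exists_truncation hf hc.le hdis R
  obtain ⟨x, xt, w, v, S⟩ := exists_sensitivityFamily A hb.le hT.le hF hK₀ hK₁ hK₂ hφc hφ0 hφtc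
    hφeq hgc (fun τ hτ => hR τ hτ F hF.continuous hF0 hFdis)
  have hfx : ∀ τ ∈ Icc 0 b, ∀ t ∈ Icc (-b) T, F =ᶠ[𝓝 (x τ t)] f := fun τ hτ t ht =>
    hFf _ (S.x_le τ hτ t ht)
  set xtt : ℝ → ℝ → Rn n := fun τ t => if t < 0 then φtt t else
    A (xt τ (t - τ)) - (fderiv ℝ F (x τ t) (xt τ t) - gt t) with hxtt
  set wt : ℝ → ℝ → Rn n := fun τ t => if t ≤ 0 then 0 else
    A (w τ (t - τ)) - fderiv ℝ F (x τ t) (w τ t) - A (xt τ (t - τ)) with hwt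
  have hxt0 : ∀ τ, xt τ 0 = A (x τ (-τ)) - (F (x τ 0) - g' 0) := fun τ => by
    rw [S.xt_eq, if_neg (lt_irrefl _), zero_sub]
  have h0T : (0 : ℝ) ∈ Icc 0 T := ⟨le_rfl, hT.le⟩
  refine ⟨x, xt, xtt, w, wt, v, fun τ => xt τ 0, fun τ hτ => ⟨⟨(S.x_cont τ hτ).continuousOn,
    fun t ht => (S.x_hist τ hτ t ht.2).trans (hφe t ht), xt τ, ?_, ?_⟩, fun y hy => ?_⟩,
    S.isTwiceContDiffL2, fun τ hτ => ?_⟩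
  · refine ⟨(S.xt_meas hτ).memLp_Ioo 0 T, fun t ht => ?_⟩
    rw [S.x_eq_primitive hτ (S.mem_of_mem ht), S.x_eq_primitive hτ (S.mem_of_mem h0T),
      intervalIntegral.integral_same, add_zero]
  · refine ae_restrict_of_forall_mem measurableSet_Ioo fun t ht => ?_
    have ht' : t ∈ Icc 0 T := ⟨ht.1.le, ht.2.le⟩
    rw [S.xt_eq, if_neg (not_lt.mpr ht.1.le), hge t ht',
      (hfx τ hτ t (S.mem_of_mem ht')).eq_of_nhds]
    abel
  · set y' : ℝ → Rn n := fun t => y (max (-b) (min t T)) with hy'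
    have hyc : Continuous y' := continuous_comp_clamp (by linarith) hy.1
    have hye : ∀ t ∈ Icc (-b) T, y' t = y t := fun t ht => by simp only [hy', clamp_of_mem ht]
    have hyh : ∀ t ≤ 0, y' t = φ' t := fun t ht => by
      simp only [hy', hφ', min_eq_left ht, min_eq_left (ht.trans hT.le)]
      exact hy.2.1 ⟨le_max_left _ _, max_le hb0 ht⟩
    have hyeq : ∀ t ∈ Ioc 0 T, y' t = φ' 0 + ∫ s in 0..t, (A (y' (s - τ)) - (f (y' s) - g' s)) :=
      fun t ht => by
        rw [hye t (S.mem_of_mem ⟨ht.1.le, ht.2⟩), hφe 0 h00]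
        exact hy.eq_integral hb hτ ht
    have hyR := hR τ hτ f hf.continuous rfl hdis y' hyc hyh hyeq
    have := S.eq_x_of_solution hτ hyc hyh fun t ht => (hyeq t ht).trans (by
      congr 1
      refine intervalIntegral.integral_congr fun s hs => ?_
      rw [uIcc_of_le ht.1.le] at hs
      simp only [(hFf (y' s) (hyR s (S.mem_of_mem ⟨hs.1, hs.2.trans ht.2⟩))).eq_of_nhds])
    intro t ht
    rw [← hye t ht]
    exact this t ht.2
  have hxeq : ∀ t ∈ Icc 0 T, xt τ t = xt τ 0 + ∫ s in 0..t, xtt τ s := fun t ht => by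
    rw [S.xt_eq_primitive hτ ht hg.integrableOn_Icc
      (by rw [hge t ht, hge 0 h0T]; exact hg.sub_eq h0T ht)]
    congr 1
    refine intervalIntegral.integral_congr fun s hs => ?_
    rw [uIcc_of_le ht.1] at hs
    simp only [hxtt, if_neg (not_lt.mpr hs.1)]
  have hxneg : ∀ r ∈ Icc (-b) 0, φt' 0 - φt' r = ∫ s in r..0, xtt τ s := fun r hr => by
    rw [hφte r hr, hφte 0 h00, hφt.sub_eq hr h00]
    refine intervalIntegral.integral_congr_ae ?_
    filter_upwards [Measure.ae_ne volume 0] with s hs0 hs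
    rw [uIoc_of_le hr.2] at hs
    simp only [hxtt, if_pos (lt_of_le_of_ne hs.2 hs0)]
  have hxtt2 : MemLp (xtt τ) 2 (volume.restrict (Ioo 0 T)) := by
    have hl : LocBddMeas fun t => A (xt τ (t - τ)) - fderiv ℝ F (x τ t) (xt τ t) :=
      (((S.xt_meas hτ).comp_sub_right τ).clm A).sub
        ((S.fderiv_x_meas hτ).clm_apply (S.xt_meas hτ))
    refine ((hl.memLp_Ioo 0 T).add hg.1).ae_eq ?_
    refine ae_restrict_of_forall_mem measurableSet_Ioo fun t ht => ?_
    simp only [hxtt, if_neg (not_lt.mpr ht.1.le), Pi.add_apply]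
    abel
  have hxtti : IntegrableOn (xtt τ) (Icc (-b) T) := by
    rw [← Icc_union_Icc_eq_Icc hb0 hT.le]
    refine IntegrableOn.union ?_ (IntegrableOn.congr_set_ae (hxtt2.integrable one_le_two)
      Ioo_ae_eq_Icc.symm)
    have h1 : IntegrableOn (xtt τ) (Ioo (-b) 0) :=
      (hφt.integrableOn_Icc.mono_set Ioo_subset_Icc_self).congr_fun
        (fun t ht => by simp only [hxtt, if_pos ht.2]) measurableSet_Ioo
    exact h1.congr_set_ae Ioo_ae_eq_Icc.symm
  have hwtm : LocBddMeas (wt τ) :=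
    .ite (p := fun t : ℝ => t ≤ 0) measurableSet_Iic (.const 0) (S.w_time_meas hτ)
  have hweq : ∀ r ∈ Icc (-b) T, w τ r = ∫ s in 0..r, wt τ s := fun r hr => by
    rcases le_or_gt r 0 with hr0 | hr0
    · rw [S.w_hist τ hτ r hr0]
      refine (intervalIntegral.integral_zero_ae (Eventually.of_forall fun s hs => ?_)).symm
      rw [uIoc_of_ge hr0] at hs
      simp only [hwt, if_pos hs.2]
    · rw [S.w_eq_primitive hτ ⟨hr0.le, hr.2⟩]
      refine intervalIntegral.integral_congr_ae (Eventually.of_forall fun s hs => ?_)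
      rw [uIoc_of_le hr0.le] at hs
      simp only [hwt, if_neg (not_le.mpr hs.1)]
  have hbT : -b ∈ Icc (-b) T := ⟨le_rfl, by linarith⟩
  have hveq := fun t (ht : t ∈ Ioc 0 T) => S.v_eq_primitive hτ ht hxtti hxneg hxeq hwtm hweq
  rw [hφte 0 h00] at hveq
  have hmi : IntegrableOn (fun t => fderiv ℝ F (x τ t) (v τ t) +
      fderiv ℝ (fderiv ℝ F) (x τ t) (w τ t) (w τ t)) (Ioo 0 T) :=
    ((S.force_v_meas hτ).integrableOn_Icc 0 T).mono_set Ioo_subset_Icc_self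
  have hhi : IntegrableOn (fun t => A (v τ (t - τ)) - (2 : ℝ) • A (wt τ (t - τ)) +
      A (xtt τ (t - τ))) (Ioo 0 T) := by
    have h1 : LocBddMeas fun t => A (v τ (t - τ)) - (2 : ℝ) • A (wt τ (t - τ)) :=
      (((S.v_meas τ hτ).comp_sub_right τ).clm A).sub
        (((hwtm.comp_sub_right τ).clm A).const_smul 2)
    have h2 : IntervalIntegrable (fun t => xtt τ (t - τ)) volume 0 T := by
      have := (hxtti.mono_set ((convex_Icc _ _).ordConnected.uIcc_subset (S.neg_mem hτ)
        (S.sub_mem hτ ⟨hT.le, le_rfl⟩))).intervalIntegrable.comp_sub_right τ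
      simpa using this
    rw [intervalIntegrable_iff_integrableOn_Ioo_of_le hT.le] at h2
    exact ((h1.integrableOn_Icc 0 T).mono_set Ioo_subset_Icc_self).add (A.integrable_comp h2)
  -- Along the solution the derivatives of `F` are those of `f`.
  have hm : ∀ t ∈ Icc 0 T, fderiv ℝ f (x τ t) (v τ t) +
      fderiv ℝ (fderiv ℝ f) (x τ t) (w τ t) (w τ t) = fderiv ℝ F (x τ t) (v τ t) +
      fderiv ℝ (fderiv ℝ F) (x τ t) (w τ t) (w τ t) := fun t ht => by
    have e := hfx τ hτ t (S.mem_of_mem ht)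
    rw [e.fderiv_eq, e.fderiv.fderiv_eq]
  have hmi' : IntegrableOn (fun t => fderiv ℝ f (x τ t) (v τ t) +
      fderiv ℝ (fderiv ℝ f) (x τ t) (w τ t) (w τ t)) (Ioo 0 T) :=
    hmi.congr_fun (fun t ht => (hm t ⟨ht.1.le, ht.2.le⟩).symm) measurableSet_Ioo
  have hveq' : ∀ t ∈ Ioc 0 T, v τ t = (∫ s in 0..t, ((A (v τ (s - τ)) -
      (2 : ℝ) • A (wt τ (s - τ)) + A (xtt τ (s - τ))) - (fderiv ℝ f (x τ s) (v τ s) +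
      fderiv ℝ (fderiv ℝ f) (x τ s) (w τ s) (w τ s)))) +
        if τ ≤ t then A (xt τ 0 - φt 0) else 0 := fun t ht => by
    rw [hveq t ht]
    congr 1
    refine intervalIntegral.integral_congr fun s hs => ?_
    rw [uIcc_of_le ht.1.le] at hs
    simp only [hm s ⟨hs.1, hs.2.trans ht.2⟩]
  refine ⟨⟨(S.xt_meas hτ).memLp_Ioo (-b) T, fun t ht => ?_⟩, ⟨hxtt2, hxeq⟩, fun t ht => ⟨?_, ?_⟩,
    ?_, ⟨hwtm.memLp_Ioo (-b) T, fun t ht => ?_⟩, fun t ht => S.w_hist τ hτ t ht.2,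
    solvesImpulsiveEquation_of_primitive hb hτ.1 (S.v_hist τ hτ) (S.v_meas τ hτ) hmi' hhi hveq',
    fun hτT => exists_jump_of_primitive hT hτ.1 hτT (S.v_hist τ hτ) (hhi.sub hmi') hveq',
    fun hcomp => ?_⟩
  · rw [← sub_eq_iff_eq_add', S.x_sub_eq hτ ht hbT, intervalIntegral.integral_interval_sub_left
      ((S.xt_meas hτ).intervalIntegrable _ _) ((S.xt_meas hτ).intervalIntegrable _ _)]
  · rw [S.xt_eq, if_pos ht.2, hφte t ⟨ht.1, ht.2.le⟩]
  · simp only [hxtt, if_pos ht.2]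
  · have h1 := ((S.xt_pos_cont hτ).tendsto 0).mono_left (nhdsWithin_le_nhds (s := Ioi 0))
    rw [zero_sub, ← hxt0] at h1
    refine h1.congr' (eventually_mem_nhdsWithin.mono fun t ht => ?_)
    rw [S.xt_eq, if_neg (not_lt.mpr (le_of_lt ht))]
  · rw [hweq t ht, hweq (-b) hbT, intervalIntegral.integral_add_adjacent_intervals
      (hwtm.intervalIntegrable _ _) (hwtm.intervalIntegrable _ _)]
  · change A (xt τ 0 - φt 0) = 0
    rw [hxt0, S.x_hist τ hτ 0 le_rfl, S.x_hist τ hτ (-τ) (by linarith [hτ.1]), hφe 0 h00,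
      hφe (-τ) ⟨by linarith [hτ.2], by linarith [hτ.1]⟩, hge 0 h0T, hcomp]
    have e := hfx τ hτ 0 (S.mem_of_mem h0T)
    rw [S.x_hist τ hτ 0 le_rfl, hφe 0 h00] at e
    rw [e.eq_of_nhds]
    refine (congrArg A ?_).trans A.map_zero
    abel
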